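/- Let $\mathcal H$ be a separable complex Hilbert space, $\mathcal B_1(\mathcal H)$ the trace class with trace norm $\|T\|_1=\operatorname{tr}\big((T^*T)^{1/2}\big)$, and let $\operatorname{tr}$ denote the trace on $\mathcal B_1(\mathcal H)$. Let $S_1,S_2\ge 0$ be nonnegative (possibly unbounded) self-adjoint operators in $\mathcal H$, and assume that $$(S_2-z_0 I)^{-1}-(S_1-z_0 I)^{-1}\in\mathcal B_1(\mathcal H)\quad\text{for some } z_0\in\rho(S_1)\cap\rho(S_2),$$ where $\rho(\cdot)$ denotes the resolvent set. For $\varphi\in(0,\pi/2)$ let $S_\varphi=\{z\in\mathbb C\setminus\{0\} : |\arg z|<\varphi\}$. Then: 1. $e^{-zS_2}-e^{-zS_1}\in\mathcal B_1(\mathcal H)$ for all $z\in\mathbb C$ with $\operatorname{Re} z>0$; 2. the function $z\mapsto \operatorname{tr}\big(e^{-zS_2}-e^{-zS_1}\big)$ is analytic in the open half-plane $\{\operatorname{Re} z>0\}$; 3. for each $\varphi\in(0,\pi/2)$ there exists a constant $C_\varphi>0$ (which may depend on $S_1,S_2$, but not on $z$) such that $$\big\|e^{-zS_2}-e^{-zS_1}\big\|_1\le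 C_\varphi\big(|z|^{-1}+|z|\big),\qquad z\in S_\varphi .$$ -/

import Mathlib

open scoped ENNReal InnerProductSpace Topology

noncomputable section

namespace HeatTrace

variable {H : Type*} [NormedAddCommGroup H] [InnerProductSpace ℂ H]

/-! ### Resolvents and nonnegative self-adjoint operators -/

/-- The bounded operator `R` is a two-sided inverse of `S - z : dom S → H`. -/
structure IsResolventAt (S : H →ₗ.[ℂ] H) (z : ℂ) (R : H →L[ℂ] H) : Prop where
  right_inv : ∀ y : H, ∃ x : S.domain, (x : H) = R y ∧ S x - z • (x : H) = y
  left_inv : ∀ x : S.domain, R (S x - z • (x : H)) = x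

/-- The resolvent set `ρ(S)`. -/
def resolventSet (S : H →ₗ.[ℂ] H) : Set ℂ := {z | ∃ R : H →L[ℂ] H, IsResolventAt S z R}

open scoped Classical in
/-- The resolvent `(S - z)⁻¹`, a bounded operator for `z ∈ ρ(S)` (and `0` otherwise). -/
def resolvent (S : H →ₗ.[ℂ] H) (z : ℂ) : H →L[ℂ] H :=
  if h : ∃ R : H →L[ℂ] H, IsResolventAt S z R then h.choose else 0

theorem IsResolventAt.resolvent_eq {S : H →ₗ.[ℂ] H} {z : ℂ} {R : H →L[ℂ] H}
    (hR : IsResolventAt S z R) : resolvent S z = R := by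
  have h : ∃ R : H →L[ℂ] H, IsResolventAt S z R := ⟨R, hR⟩
  rw [resolvent, dif_pos h]
  ext y
  obtain ⟨x, hx, hy⟩ := hR.right_inv y
  rw [← hx, ← hy, h.choose_spec.left_inv x]

theorem isResolventAt_resolvent {S : H →ₗ.[ℂ] H} {z : ℂ} (hz : z ∈ resolventSet S) :
    IsResolventAt S z (resolvent S z) := by
  obtain ⟨R, hR⟩ := hz
  rwa [hR.resolvent_eq]

theorem ofReal_norm_sq_eq_tsum {ι : Type*} (b : HilbertBasis ι ℂ H) (x : H) :
    ENNReal.ofReal (‖x‖ ^ 2) = ∑' i, ENNReal.ofReal (‖⟪b i, x⟫_ℂ‖ ^ 2) := by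
  have h : HasSum (fun i => ‖⟪b i, x⟫_ℂ‖ ^ 2) (‖x‖ ^ 2) := by
    have h1 := Complex.hasSum_re (b.hasSum_inner_mul_inner x x)
    have h2 : (⟪x, x⟫_ℂ).re = ‖x‖ ^ 2 := inner_self_eq_norm_sq (𝕜 := ℂ) x
    rw [h2] at h1
    refine h1.congr_fun ?_
    intro i
    rw [← inner_conj_symm x (b i), ← Complex.normSq_eq_conj_mul_self, Complex.ofReal_re,
      Complex.normSq_eq_norm_sq]
  rw [← h.tsum_eq, ENNReal.ofReal_tsum_of_nonneg (fun i => by positivity) h.summable]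

variable [CompleteSpace H]

/-- `S` is a (possibly unbounded) self-adjoint operator, and it is nonnegative:
`0 ≤ ⟪x, S x⟫` for all `x` in its domain. -/
structure IsNonnegSelfAdjoint (S : H →ₗ.[ℂ] H) : Prop where
  isSelfAdjoint : IsSelfAdjoint S
  nonneg : ∀ x : S.domain, 0 ≤ (⟪(x : H), S x⟫_ℂ).re

/-! ### Functional calculus and the semigroup -/

/-- The operator `f(S)`, for `S ≥ 0` self-adjoint and `f : [0, ∞) → ℂ` continuous and vanishing
at infinity. The bounded operator `A = (S + 1)⁻¹` satisfies `0 ≤ A ≤ 1`, and `S = A⁻¹ - 1`; hence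
`f(S) = g(A)`, where `g(t) = f(t⁻¹ - 1)` for `t ∈ (0, 1]` and `g(0) = f(∞) = 0`. -/
def funcCalc (S : H →ₗ.[ℂ] H) (f : ℝ → ℂ) : H →L[ℂ] H :=
  cfc (fun w : ℂ => if w = 0 then 0 else f (w.re⁻¹ - 1)) (resolvent S (-1))

/-- The operator `e^{-zS}`, for `S ≥ 0` self-adjoint and `Re z > 0`. -/
def expNeg (S : H →ₗ.[ℂ] H) (z : ℂ) : H →L[ℂ] H :=
  funcCalc S fun l => Complex.exp (-(z * l))

/-! ### Trace class operators -/

variable (H) in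
/-- The index set of a fixed orthonormal basis of `H`. -/
def basisIndex : Set H := (exists_hilbertBasis ℂ H).choose

variable (H) in
/-- A fixed orthonormal basis of `H`. -/
def onb : HilbertBasis (basisIndex H) ℂ H := (exists_hilbertBasis ℂ H).choose_spec.choose

/-- The trace norm `‖T‖₁ = tr |T|`, `|T| = (T* T)^{1/2}`, with values in `[0, ∞]`.
The terms are nonnegative, and the sum is the same for all orthonormal bases. -/
def traceNorm (T : H →L[ℂ] H) : ℝ≥0∞ :=
  ∑' i, ENNReal.ofReal (⟪onb H i, CFC.abs T (onb H i)⟫_ℂ).re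

/-- `T` belongs to the trace class `B₁(H)`. -/
def IsTraceClass (T : H →L[ℂ] H) : Prop := traceNorm T < ∞

/-- The trace of a trace class operator `T`. For such `T` the sum converges absolutely, to the
same value for all orthonormal bases. -/
def trace (T : H →L[ℂ] H) : ℂ := ∑' i, ⟪onb H i, T (onb H i)⟫_ℂ

/-- The open sector of half-angle `φ` around the positive half-line (without its vertex). -/
def sector (φ : ℝ) : Set ℂ := {z | z ≠ 0 ∧ |z.arg| < φ}

/-! ### The definitions have their intended meaning

For all self-adjoint `S ≥ 0` one has `-1 ∈ ρ(S)` and `0 ≤ (S + 1)⁻¹ ≤ 1`, and `z ↦ e^{-zS}` is the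
semigroup generated by `-S`: `e^{-(z+w)S} = e^{-zS} e^{-wS}`, `(d/dz) e^{-zS} x = -e^{-zS} S x` for
`x` in the domain of `S`, and `e^{-tS} x → x` as `t ↓ 0` for all `x`. The
trace norm does not depend on the orthonormal basis. -/

theorem IsNonnegSelfAdjoint.norm_le {S : H →ₗ.[ℂ] H} (hS : IsNonnegSelfAdjoint S)
    (x : S.domain) : ‖(x : H)‖ ≤ ‖S x + x‖ := by
  have h1 : (⟪(x : H), S x + x⟫_ℂ).re ≤ ‖(x : H)‖ * ‖S x + x‖ := re_inner_le_norm (𝕜 := ℂ) _ _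
  have h2 : (⟪(x : H), (x : H)⟫_ℂ).re = ‖(x : H)‖ ^ 2 := inner_self_eq_norm_sq (𝕜 := ℂ) _
  rw [inner_add_right, Complex.add_re, h2] at h1
  have h3 := hS.nonneg x
  rcases (norm_nonneg (x : H)).eq_or_lt with h | h
  · rw [← h]; exact norm_nonneg _
  · nlinarith

theorem IsNonnegSelfAdjoint.exists_add_eq {S : H →ₗ.[ℂ] H} (hS : IsNonnegSelfAdjoint S)
    (y : H) : ∃ x : S.domain, S x + x = y := by
  have hd := hS.isSelfAdjoint.dense_domain
  have hc : IsClosed (S.graph : Set (H × H)) := hS.isSelfAdjoint.isClosed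
  have : CompleteSpace S.graph := hc.completeSpace_coe
  let L : S.graph →L[ℂ] H := (ContinuousLinearMap.fst ℂ H H + ContinuousLinearMap.snd ℂ H H).comp
    S.graph.subtypeL
  have hL : ∀ x : S.domain, ∀ h : ((x : H), S x) ∈ S.graph, L ⟨((x : H), S x), h⟩ = x + S x :=
    fun x h => rfl
  have hanti : AntilipschitzWith 2 L := by
    refine AddMonoidHomClass.antilipschitz_of_bound L ?_
    rintro ⟨⟨a, b⟩, hab⟩
    obtain ⟨x, rfl, rfl⟩ := (LinearPMap.mem_graph_iff S).1 hab
    rw [hL]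
    have h1 := hS.norm_le x
    have h2 : ‖S x‖ ≤ ‖S x + x‖ + ‖(x : H)‖ := by simpa using norm_sub_le (S x + x) (x : H)
    rw [add_comm]
    change max ‖(x : H)‖ ‖S x‖ ≤ 2 * _
    exact max_le (by linarith [norm_nonneg (S x + x)]) (by linarith)
  have hcl : IsClosed (LinearMap.range L.toLinearMap : Set H) := by
    have h := hanti.isClosed_range L.uniformContinuous
    exact h
  have : CompleteSpace (LinearMap.range L.toLinearMap) := hcl.completeSpace_coe
  have htop : LinearMap.range L.toLinearMap = ⊤ := by
    rw [← Submodule.orthogonal_eq_bot_iff, Submodule.eq_bot_iff]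
    intro v hv
    have key : ∀ x : S.domain, ⟪-v, (x : H)⟫_ℂ = ⟪v, S x⟫_ℂ := by
      intro x
      have := (Submodule.mem_orthogonal' _ _).1 hv _
        ⟨⟨((x : H), S x), S.mem_graph x⟩, rfl⟩
      change ⟪v, (x : H) + S x⟫_ℂ = 0 at this
      rw [inner_add_right] at this
      rw [inner_neg_left]
      linear_combination -this
    have hadj : S.adjoint = S := hS.isSelfAdjoint
    have hmem : v ∈ S.adjoint.domain := LinearPMap.mem_adjoint_domain_of_exists v ⟨-v, key⟩
    have happ : S.adjoint ⟨v, hmem⟩ = -v := LinearPMap.adjoint_apply_eq hd _ key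
    have hpos : ∀ u : S.adjoint.domain, 0 ≤ (⟪(u : H), S.adjoint u⟫_ℂ).re := by
      rw [hadj]; exact hS.nonneg
    have h0 := hpos ⟨v, hmem⟩
    rw [happ] at h0
    have h2 : (⟪v, v⟫_ℂ).re = ‖v‖ ^ 2 := inner_self_eq_norm_sq (𝕜 := ℂ) _
    simp only [inner_neg_right, Complex.neg_re, h2] at h0
    have : ‖v‖ = 0 := by nlinarith [sq_nonneg ‖v‖]
    simpa using this
  have hy : y ∈ LinearMap.range L.toLinearMap := by rw [htop]; trivial
  obtain ⟨⟨⟨a, b⟩, hab⟩, h⟩ := hy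
  obtain ⟨x, rfl, rfl⟩ := (LinearPMap.mem_graph_iff S).1 hab
  refine ⟨x, ?_⟩
  rw [add_comm]
  exact h

theorem IsNonnegSelfAdjoint.neg_one_mem {S : H →ₗ.[ℂ] H} (hS : IsNonnegSelfAdjoint S) :
    (-1 : ℂ) ∈ resolventSet S := by
  let T : S.domain →ₗ[ℂ] H := S.toFun + S.domain.subtype
  have hT : ∀ x : S.domain, T x = S x + x := fun x => rfl
  have hinj : Function.Injective T := by
    rw [injective_iff_map_eq_zero]
    intro x hx
    have := hS.norm_le x
    rw [← hT, hx, norm_zero] at this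
    exact Subtype.ext (norm_le_zero_iff.1 this)
  let e := LinearEquiv.ofBijective T ⟨hinj, hS.exists_add_eq⟩
  have he : ∀ y, T (e.symm y) = y := fun y => e.apply_symm_apply y
  refine ⟨(S.domain.subtype ∘ₗ e.symm.toLinearMap).mkContinuous 1 fun y => ?_, fun y => ?_,
    fun x => ?_⟩
  · have := hS.norm_le (e.symm y)
    rw [← hT, he] at this
    simpa using this
  · refine ⟨e.symm y, rfl, ?_⟩
    have := he y
    rw [hT] at this
    simpa using this
  · have : S x - (-1 : ℂ) • (x : H) = e x := by
      rw [show e x = S x + x from rfl]; simp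
    rw [this]
    simp

theorem IsNonnegSelfAdjoint.exists_resolvent_eq {S : H →ₗ.[ℂ] H} (hS : IsNonnegSelfAdjoint S)
    (y : H) : ∃ x : S.domain, (x : H) = resolvent S (-1) y ∧ S x + x = y := by
  obtain ⟨x, hx, hy⟩ := (isResolventAt_resolvent hS.neg_one_mem).right_inv y
  exact ⟨x, hx, by simpa using hy⟩

theorem IsNonnegSelfAdjoint.inner_map {S : H →ₗ.[ℂ] H} (hS : IsNonnegSelfAdjoint S)
    (x y : S.domain) : ⟪S x, (y : H)⟫_ℂ = ⟪(x : H), S y⟫_ℂ := by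
  have h := LinearPMap.adjoint_isFormalAdjoint hS.isSelfAdjoint.dense_domain
  have hadj : S.adjoint = S := hS.isSelfAdjoint
  rw [hadj] at h
  exact h x y

theorem IsNonnegSelfAdjoint.resolvent_nonneg {S : H →ₗ.[ℂ] H} (hS : IsNonnegSelfAdjoint S) :
    0 ≤ resolvent S (-1) := by
  rw [ContinuousLinearMap.nonneg_iff_isPositive, ContinuousLinearMap.isPositive_def]
  constructor
  · intro u v
    obtain ⟨x, hx, hu⟩ := hS.exists_resolvent_eq u
    obtain ⟨y, hy, hv⟩ := hS.exists_resolvent_eq v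
    change ⟪resolvent S (-1) u, v⟫_ℂ = ⟪u, resolvent S (-1) v⟫_ℂ
    rw [← hx, ← hy, ← hu, ← hv, inner_add_left, inner_add_right, hS.inner_map]
  · intro u
    obtain ⟨x, hx, hu⟩ := hS.exists_resolvent_eq u
    change 0 ≤ (⟪resolvent S (-1) u, u⟫_ℂ).re
    rw [← hx, ← hu, inner_add_right, Complex.add_re]
    exact add_nonneg (hS.nonneg x) (inner_self_nonneg (𝕜 := ℂ))

theorem IsNonnegSelfAdjoint.isStarNormal_resolvent {S : H →ₗ.[ℂ] H}
    (hS : IsNonnegSelfAdjoint S) : IsStarNormal (resolvent S (-1)) :=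
  (IsSelfAdjoint.of_nonneg hS.resolvent_nonneg).isStarNormal

theorem IsNonnegSelfAdjoint.norm_resolvent_le {S : H →ₗ.[ℂ] H} (hS : IsNonnegSelfAdjoint S) :
    ‖resolvent S (-1)‖ ≤ 1 := by
  refine ContinuousLinearMap.opNorm_le_bound _ zero_le_one fun y => ?_
  obtain ⟨x, hx, hy⟩ := hS.exists_resolvent_eq y
  rw [← hx, ← hy, one_mul]
  exact hS.norm_le x

theorem IsNonnegSelfAdjoint.mem_spectrum {S : H →ₗ.[ℂ] H} (hS : IsNonnegSelfAdjoint S) {w : ℂ}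
    (hw : w ∈ spectrum ℂ (resolvent S (-1))) : ∃ t : ℝ, 0 ≤ t ∧ t ≤ 1 ∧ w = t := by
  have h0 : 0 ≤ w.re ∧ w.im = 0 := by
    open scoped ComplexOrder in
    have := spectrum_nonneg_of_nonneg hS.resolvent_nonneg hw
    rw [Complex.nonneg_iff] at this
    exact ⟨this.1, this.2.symm⟩
  have h1 := spectrum.norm_le_norm_mul_of_mem hw
  have h2 : ‖(1 : H →L[ℂ] H)‖ ≤ 1 := ContinuousLinearMap.norm_id_le
  have h3 := hS.norm_resolvent_le
  refine ⟨w.re, h0.1, ?_, Complex.ext rfl (by simp [h0.2])⟩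
  calc w.re ≤ ‖w‖ := Complex.re_le_norm w
    _ ≤ _ := h1
    _ ≤ 1 * 1 := by gcongr
    _ = 1 := one_mul 1

/-- The function of the bounded operator `(S + 1)⁻¹` that defines `e^{-zS}`. -/
def expSymbol (z w : ℂ) : ℂ := if w = 0 then 0 else Complex.exp (-(z * ((w.re⁻¹ - 1 : ℝ) : ℂ)))

theorem expNeg_eq (S : H →ₗ.[ℂ] H) (z : ℂ) :
    expNeg S z = cfc (expSymbol z) (resolvent S (-1)) := rfl

theorem IsNonnegSelfAdjoint.continuousOn_expSymbol {S : H →ₗ.[ℂ] H} (hS : IsNonnegSelfAdjoint S)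
    {z : ℂ} (hz : 0 < z.re) : ContinuousOn (expSymbol z) (spectrum ℂ (resolvent S (-1))) := by
  intro w hw
  by_cases h : w = 0
  · subst h
    have h0 : expSymbol z 0 = 0 := by simp [expSymbol]
    rw [ContinuousWithinAt, h0]
    refine squeeze_zero_norm' (a := fun w : ℂ => ‖w‖ * (z.re⁻¹ * Real.exp z.re)) ?_ ?_
    · filter_upwards [self_mem_nhdsWithin] with w hw
      obtain ⟨t, ht0, ht1, rfl⟩ := hS.mem_spectrum hw
      rcases ht0.eq_or_lt with rfl | ht
      · simp [expSymbol]
      · have : (t : ℂ) ≠ 0 := by exact_mod_cast ht.ne'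
        rw [expSymbol, if_neg this, Complex.norm_exp, Complex.norm_real, Real.norm_eq_abs,
          abs_of_pos ht]
        have e1 : (-(z * (((t : ℂ).re⁻¹ - 1 : ℝ) : ℂ))).re = z.re + -(z.re / t) := by
          simp [Complex.mul_re]; ring
        rw [e1, Real.exp_add, Real.exp_neg]
        have e2 : z.re / t ≤ Real.exp (z.re / t) := by linarith [Real.add_one_le_exp (z.re / t)]
        have e3 : (Real.exp (z.re / t))⁻¹ ≤ (z.re / t)⁻¹ := by gcongr
        calc Real.exp z.re * (Real.exp (z.re / t))⁻¹ ≤ Real.exp z.re * (z.re / t)⁻¹ := by gcongr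
          _ = t * (z.re⁻¹ * Real.exp z.re) := by rw [inv_div]; ring
    · have : Filter.Tendsto (fun w : ℂ => ‖w‖ * (z.re⁻¹ * Real.exp z.re)) (𝓝 0)
          (𝓝 (‖(0 : ℂ)‖ * (z.re⁻¹ * Real.exp z.re))) := by
        apply Continuous.tendsto; fun_prop
      rw [norm_zero, zero_mul] at this
      exact this.mono_left nhdsWithin_le_nhds
  · obtain ⟨t, ht0, ht1, rfl⟩ := hS.mem_spectrum hw
    have ht : t ≠ 0 := by exact_mod_cast h
    have : (fun w : ℂ => Complex.exp (-(z * ((w.re⁻¹ - 1 : ℝ) : ℂ)))) =ᶠ[𝓝 (t : ℂ)]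
        expSymbol z := by
      filter_upwards [isOpen_ne.mem_nhds h] with w hw
      rw [expSymbol, if_neg hw]
    refine (ContinuousAt.congr ?_ this).continuousWithinAt
    have : (t : ℂ).re ≠ 0 := by simpa using ht
    fun_prop (disch := assumption)

theorem IsNonnegSelfAdjoint.expNeg_add {S : H →ₗ.[ℂ] H} (hS : IsNonnegSelfAdjoint S) {z w : ℂ}
    (hz : 0 < z.re) (hw : 0 < w.re) : expNeg S (z + w) = expNeg S z * expNeg S w := by
  simp only [expNeg_eq]
  rw [← cfc_mul _ _ _ (hS.continuousOn_expSymbol hz) (hS.continuousOn_expSymbol hw)]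
  congr 1
  ext u
  by_cases hu : u = 0
  · simp [expSymbol, hu]
  · simp only [expSymbol, hu, if_false, ← Complex.exp_add]
    congr 1; ring

theorem expSymbol_ofReal (z : ℂ) {t : ℝ} (ht : t ≠ 0) :
    expSymbol z t = Complex.exp (-(z * ((t⁻¹ - 1 : ℝ) : ℂ))) := by
  have : (t : ℂ) ≠ 0 := by exact_mod_cast ht
  rw [expSymbol, if_neg this, Complex.ofReal_re]

theorem IsNonnegSelfAdjoint.norm_expNeg_le {S : H →ₗ.[ℂ] H} (hS : IsNonnegSelfAdjoint S) {z : ℂ}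
    (hz : 0 < z.re) : ‖expNeg S z‖ ≤ 1 := by
  rw [expNeg_eq]
  refine norm_cfc_le zero_le_one fun w hw => ?_
  obtain ⟨t, ht0, ht1, rfl⟩ := hS.mem_spectrum hw
  rcases ht0.eq_or_lt with rfl | ht
  · simp [expSymbol]
  · rw [expSymbol_ofReal z ht.ne', Complex.norm_exp, Real.exp_le_one_iff, Complex.neg_re,
      Complex.re_mul_ofReal]
    have : 1 ≤ t⁻¹ := (one_le_inv₀ ht).2 ht1
    have := mul_nonneg hz.le (sub_nonneg.2 this)
    linarith

theorem IsNonnegSelfAdjoint.norm_expNeg_mul_sub_le {S : H →ₗ.[ℂ] H} (hS : IsNonnegSelfAdjoint S)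
    {s : ℝ} (hs : 0 < s) : ‖expNeg S s * resolvent S (-1) - resolvent S (-1)‖ ≤ s := by
  have hA := hS.isStarNormal_resolvent
  have hz : 0 < (s : ℂ).re := by simpa using hs
  have hc := hS.continuousOn_expSymbol hz
  have e : expNeg S s * resolvent S (-1) - resolvent S (-1) =
      cfc (fun w => expSymbol s w * w - w) (resolvent S (-1)) := by
    have c1 : ContinuousOn (fun w => expSymbol s w * w) (spectrum ℂ (resolvent S (-1))) :=
      hc.mul continuousOn_id
    have c2 : ContinuousOn (fun w : ℂ => w) (spectrum ℂ (resolvent S (-1))) := continuousOn_id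
    rw [cfc_sub _ _ _ c1 c2, cfc_mul _ _ _ hc c2, cfc_id' ℂ (resolvent S (-1)), expNeg_eq]
  rw [e]
  refine norm_cfc_le hs.le fun w hw => ?_
  obtain ⟨t, ht0, ht1, rfl⟩ := hS.mem_spectrum hw
  rcases ht0.eq_or_lt with rfl | ht
  · simpa using hs.le
  · have h1 : 0 ≤ t⁻¹ - 1 := sub_nonneg.2 ((one_le_inv₀ ht).2 ht1)
    have h2 : expSymbol s t * t - t = ((t * (Real.exp (-(s * (t⁻¹ - 1))) - 1) : ℝ) : ℂ) := by
      rw [expSymbol_ofReal _ ht.ne']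
      push_cast
      ring
    rw [h2, Complex.norm_real, Real.norm_eq_abs, abs_mul, abs_of_pos ht, abs_sub_comm,
      abs_of_nonneg (by
        rw [sub_nonneg, Real.exp_le_one_iff]; have := mul_nonneg hs.le h1; linarith)]
    have h3 := Real.add_one_le_exp (-(s * (t⁻¹ - 1)))
    calc t * (1 - Real.exp (-(s * (t⁻¹ - 1)))) ≤ t * (s * (t⁻¹ - 1)) := by gcongr; linarith
      _ = s * (1 - t) := by field_simp
      _ ≤ s := by nlinarith

theorem IsNonnegSelfAdjoint.tendsto_expNeg {S : H →ₗ.[ℂ] H} (hS : IsNonnegSelfAdjoint S) (x : H) :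
    Filter.Tendsto (fun t : ℝ => expNeg S t x) (𝓝[>] 0) (𝓝 x) := by
  rw [Metric.tendsto_nhds]
  intro ε hε
  obtain ⟨v, hv, hxv⟩ := hS.isSelfAdjoint.dense_domain.exists_dist_lt x (ε := ε / 4) (by positivity)
  set y : H := S ⟨v, hv⟩ + v with hy
  have hAy : resolvent S (-1) y = v := by
    have := (isResolventAt_resolvent hS.neg_one_mem).left_inv ⟨v, hv⟩
    simpa [hy] using this
  have hδ : 0 < ε / 4 / (‖y‖ + 1) := by positivity
  filter_upwards [Ioo_mem_nhdsGT hδ] with t ht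
  have ht0 : 0 < (t : ℂ).re := by simpa using ht.1
  have h1 : ‖expNeg S t (x - v)‖ ≤ ε / 4 := by
    calc _ ≤ 1 * ‖x - v‖ := (expNeg S t).le_of_opNorm_le (hS.norm_expNeg_le ht0) _
      _ ≤ ε / 4 := by rw [one_mul, ← dist_eq_norm]; exact hxv.le
  have h2 : ‖expNeg S t v - v‖ ≤ ε / 4 := by
    have := (expNeg S t * resolvent S (-1) - resolvent S (-1)).le_of_opNorm_le
      (hS.norm_expNeg_mul_sub_le ht.1) y
    simp only [sub_apply, mul_apply_eq_comp, hAy] at this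
    refine this.trans ?_
    calc t * ‖y‖ ≤ ε / 4 / (‖y‖ + 1) * (‖y‖ + 1) := by
          gcongr
          · exact ht.2.le
          · linarith
      _ = ε / 4 := by field_simp
  have h3 : ‖x - v‖ < ε / 4 := by rwa [← dist_eq_norm]
  rw [dist_eq_norm]
  calc ‖expNeg S t x - x‖ = ‖expNeg S t (x - v) + (expNeg S t v - v) - (x - v)‖ := by
        congr 1; rw [map_sub]; abel
    _ ≤ ‖expNeg S t (x - v)‖ + ‖expNeg S t v - v‖ + ‖x - v‖ :=
        (norm_sub_le _ _).trans (by gcongr; exact norm_add_le _ _)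
    _ < ε := by linarith

theorem IsNonnegSelfAdjoint.norm_expNeg_taylor_le {S : H →ₗ.[ℂ] H} (hS : IsNonnegSelfAdjoint S)
    {z h : ℂ} (hz : 0 < z.re) (hh : ‖h‖ ≤ z.re / 2) :
    ‖expNeg S (z + h) * resolvent S (-1) - expNeg S z * resolvent S (-1) +
      h • (expNeg S z * (1 - resolvent S (-1)))‖ ≤ 8 / z.re ^ 2 * ‖h‖ ^ 2 := by
  have hA := hS.isStarNormal_resolvent
  have hzh : 0 < (z + h).re := by
    have := (abs_le.1 ((Complex.abs_re_le_norm h).trans hh)).1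
    rw [Complex.add_re]; linarith
  have hc := hS.continuousOn_expSymbol hz
  have hc' := hS.continuousOn_expSymbol hzh
  have e : expNeg S (z + h) * resolvent S (-1) - expNeg S z * resolvent S (-1) +
      h • (expNeg S z * (1 - resolvent S (-1))) =
      cfc (fun w => (expSymbol (z + h) w * w - expSymbol z w * w) + h * (expSymbol z w * (1 - w)))
        (resolvent S (-1)) := by
    have c0 : ContinuousOn (fun w : ℂ => w) (spectrum ℂ (resolvent S (-1))) := continuousOn_id
    have c1 : ContinuousOn (fun w => expSymbol z w * w) (spectrum ℂ (resolvent S (-1))) :=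
      hc.mul c0
    have c2 : ContinuousOn (fun w => expSymbol (z + h) w * w) (spectrum ℂ (resolvent S (-1))) :=
      hc'.mul c0
    have c3 : ContinuousOn (fun w : ℂ => 1 - w) (spectrum ℂ (resolvent S (-1))) :=
      continuousOn_const.sub c0
    have c4 : ContinuousOn (fun w => expSymbol z w * (1 - w)) (spectrum ℂ (resolvent S (-1))) :=
      hc.mul c3
    have c5 : ContinuousOn (fun w => h * (expSymbol z w * (1 - w)))
        (spectrum ℂ (resolvent S (-1))) := continuousOn_const.mul c4
    have c6 : ContinuousOn (fun w => expSymbol (z + h) w * w - expSymbol z w * w)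
        (spectrum ℂ (resolvent S (-1))) := c2.sub c1
    rw [cfc_add _ _ _ c6 c5, cfc_sub _ _ _ c2 c1, cfc_mul _ _ _ hc c0, cfc_mul _ _ _ hc' c0,
      cfc_const_mul _ _ _ c4, cfc_mul _ _ _ hc c3, cfc_sub _ _ _ continuousOn_const c0,
      cfc_const_one ℂ _, cfc_id' ℂ (resolvent S (-1)), expNeg_eq, expNeg_eq]
  rw [e]
  refine norm_cfc_le (by positivity) fun w hw => ?_
  obtain ⟨t, ht0, ht1, rfl⟩ := hS.mem_spectrum hw
  rcases ht0.eq_or_lt with rfl | ht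
  · simp [expSymbol]; positivity
  set l : ℝ := t⁻¹ - 1 with hl
  have hl0 : 0 ≤ l := sub_nonneg.2 ((one_le_inv₀ ht).2 ht1)
  have htl : (1 : ℂ) - t = t * l := by
    have : (1 : ℝ) - t = t * l := by rw [hl]; field_simp
    exact_mod_cast this
  set u : ℂ := -(h * l) with hu
  have hun : ‖u‖ = ‖h‖ * l := by
    rw [hu, norm_neg, norm_mul, Complex.norm_real, Real.norm_eq_abs, abs_of_nonneg hl0]
  have e2 : (expSymbol (z + h) t * t - expSymbol z t * t) + h * (expSymbol z t * (1 - t)) =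
      t * Complex.exp (-(z * l)) * (Complex.exp u - ∑ m ∈ Finset.range 2, u ^ m / m.factorial) := by
    rw [expSymbol_ofReal _ ht.ne', expSymbol_ofReal _ ht.ne', htl, ← hl,
      show -((z + h) * (l : ℂ)) = -(z * l) + u by rw [hu]; ring, Complex.exp_add]
    simp only [Finset.sum_range_succ, Finset.sum_range_zero, Nat.factorial]
    push_cast
    rw [hu]
    ring
  have e3 := Complex.norm_exp_sub_sum_le_norm_mul_exp u 2
  have e4 : ‖Complex.exp (-(z * l))‖ = Real.exp (-(z.re * l)) := by
    rw [Complex.norm_exp, Complex.neg_re, Complex.re_mul_ofReal]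
  rw [e2, norm_mul, norm_mul, e4, Complex.norm_real, Real.norm_eq_abs, abs_of_pos ht]
  have hcl : 0 ≤ z.re / 2 * l := by positivity
  have e5 : Real.exp ‖u‖ ≤ Real.exp (z.re / 2 * l) := by rw [hun]; gcongr
  have e6 := Real.quadratic_le_exp_of_nonneg hcl
  have e7 : l ^ 2 ≤ 8 / z.re ^ 2 * Real.exp (z.re / 2 * l) := by
    have : (z.re / 2 * l) ^ 2 / 2 ≤ Real.exp (z.re / 2 * l) := by linarith
    calc l ^ 2 = 8 / z.re ^ 2 * ((z.re / 2 * l) ^ 2 / 2) := by field_simp; ring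
      _ ≤ _ := by gcongr
  calc t * Real.exp (-(z.re * l)) * _
      ≤ 1 * Real.exp (-(z.re * l)) * (‖u‖ ^ 2 * Real.exp ‖u‖) := by gcongr
    _ ≤ 1 * Real.exp (-(z.re * l)) * ((‖h‖ * l) ^ 2 * Real.exp (z.re / 2 * l)) := by
        rw [← hun]; gcongr
    _ = Real.exp (-(z.re * l)) * Real.exp (z.re / 2 * l) * ‖h‖ ^ 2 * l ^ 2 := by ring
    _ ≤ Real.exp (-(z.re * l)) * Real.exp (z.re / 2 * l) * ‖h‖ ^ 2 *
        (8 / z.re ^ 2 * Real.exp (z.re / 2 * l)) := by gcongr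
    _ = 8 / z.re ^ 2 * ‖h‖ ^ 2 * (Real.exp (-(z.re * l)) * Real.exp (z.re / 2 * l) *
        Real.exp (z.re / 2 * l)) := by ring
    _ = 8 / z.re ^ 2 * ‖h‖ ^ 2 := by
        rw [← Real.exp_add, ← Real.exp_add,
          show -(z.re * l) + z.re / 2 * l + z.re / 2 * l = 0 by ring, Real.exp_zero, mul_one]

theorem IsNonnegSelfAdjoint.hasDerivAt_expNeg {S : H →ₗ.[ℂ] H} (hS : IsNonnegSelfAdjoint S)
    {z : ℂ} (hz : 0 < z.re) (x : S.domain) :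
    HasDerivAt (fun z => expNeg S z (x : H)) (-expNeg S z (S x)) z := by
  have hAx : resolvent S (-1) (S x + x) = x := by
    simpa using (isResolventAt_resolvent hS.neg_one_mem).left_inv x
  rw [hasDerivAt_iff_isLittleO_nhds_zero]
  refine Asymptotics.IsBigO.trans_isLittleO (g := fun h : ℂ => ‖h‖ ^ 2) ?_ ?_
  · refine Asymptotics.IsBigO.of_bound (8 / z.re ^ 2 * ‖S x + x‖) ?_
    filter_upwards [Metric.closedBall_mem_nhds (0 : ℂ) (half_pos hz)] with h hh
    have h1 := ContinuousLinearMap.le_of_opNorm_le _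
      (hS.norm_expNeg_taylor_le hz (by simpa using hh)) (S x + x)
    simp only [add_apply, sub_apply,
      smul_apply, mul_apply_eq_comp, one_apply_eq_self,
      hAx, add_sub_cancel_right] at h1
    rw [smul_neg, sub_neg_eq_add, norm_pow, norm_norm]
    linarith
  · simpa using Asymptotics.isLittleO_norm_pow_id (E' := ℂ) one_lt_two

/-- The trace norm can be computed in every orthonormal basis. -/
theorem traceNorm_eq {ι : Type*} (b : HilbertBasis ι ℂ H) (T : H →L[ℂ] H) :
    traceNorm T = ∑' i, ENNReal.ofReal (⟪b i, CFC.abs T (b i)⟫_ℂ).re := by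
  set Q := CFC.sqrt (CFC.abs T) with hQ
  have hQs : IsSelfAdjoint Q := IsSelfAdjoint.of_nonneg (CFC.sqrt_nonneg _)
  have hsymm : ∀ x y : H, ⟪Q x, y⟫_ℂ = ⟪x, Q y⟫_ℂ := hQs.isSymmetric
  have hQQ : Q * Q = CFC.abs T := CFC.sqrt_mul_sqrt_self _ (CFC.abs_nonneg T)
  have h1 : ∀ x : H, (⟪x, CFC.abs T x⟫_ℂ).re = ‖Q x‖ ^ 2 := by
    intro x
    have : (⟪Q x, Q x⟫_ℂ).re = ‖Q x‖ ^ 2 := inner_self_eq_norm_sq (𝕜 := ℂ) (Q x)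
    rw [← this, hsymm, ← hQQ]
    rfl
  simp only [traceNorm, h1]
  calc ∑' i, ENNReal.ofReal (‖Q (onb H i)‖ ^ 2)
      = ∑' i, ∑' j, ENNReal.ofReal (‖⟪b j, Q (onb H i)⟫_ℂ‖ ^ 2) := by
        simp only [← ofReal_norm_sq_eq_tsum b]
    _ = ∑' j, ∑' i, ENNReal.ofReal (‖⟪b j, Q (onb H i)⟫_ℂ‖ ^ 2) := ENNReal.tsum_comm
    _ = ∑' j, ∑' i, ENNReal.ofReal (‖⟪onb H i, Q (b j)⟫_ℂ‖ ^ 2) := by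
        simp only [← hsymm, norm_inner_symm]
    _ = ∑' j, ENNReal.ofReal (‖Q (b j)‖ ^ 2) := by
        simp only [← ofReal_norm_sq_eq_tsum (onb H)]

end HeatTrace

end

/-! Write `A_j = (S_j + 1)⁻¹`, `E_j(z) = e^{-zS_j}` and `G_j(z) = (S_j + 1)e^{-zS_j}`, so that
`‖E_j(z)‖ ≤ 1` and `‖G_j(z)‖ ≤ 1 + 1/Re z`. The resolvent difference at any common point is a
product with the one at `z₀` in the middle, so `A₂ - A₁` is trace class, say with trace norm at most
`K`.

The core is a Duhamel argument. The derivative of `E₂((2-s)w) E₁(sw) A₁` in `s` is `w G₂((2-s)w)(A₁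
- A₂)E₁(sw)`; the factor `A₁` keeps everything bounded. For `0 < s ≤ 1` the argument of `G₂` has
real part at least `Re w`, so the increment over `[0, 1]` is trace class. Multiplying by `G₂(w)` and
replacing `A₁` by `A₂`, at the cost of two more terms containing `A₂ - A₁`, gives a bound for
`E₂(2w)(E₂(w) - E₁(w))` (`traceBound_expNeg_mul_sub`). Adjoints and exchange of the operators give
`(E₂(w) - E₁(w))E₁(2w)`. In the telescoping sum for `E₂(w)⁴ - E₁(w)⁴` every term contains one of
these two products, and `E_j(w)⁴ = E_j(4w)`. In a sector `Re z` is comparable to `|z|`, whence the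
bound `C(|z|⁻¹ + |z|)`.

Trace norms are handled by duality (`traceNorm_le_iff`): a bound is a family of scalar inequalities
for finite sums, each continuous in operator norm, so limits and the mean value inequality apply
without trace-norm integrals. The trace is analytic as a pointwise limit of locally bounded
holomorphic partial sums. -/

namespace HeatTrace

variable {H : Type*} [NormedAddCommGroup H] [InnerProductSpace ℂ H]

/-! ### Duality for the trace norm -/

/-- A finite family satisfying Bessel's inequality, i.e. the image of an orthonormal family under
a contraction. -/
def IsBessel {ι : Type*} (F : Finset ι) (u : ι → H) : Prop :=
  ∀ x : H, ∑ i ∈ F, ‖⟪u i, x⟫_ℂ‖ ^ 2 ≤ ‖x‖ ^ 2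

theorem isBessel_hilbertBasis {ι : Type*} (b : HilbertBasis ι ℂ H) (F : Finset ι) :
    IsBessel F b := fun x => b.orthonormal.sum_inner_products_le x (s := F)

/-- Each vector of a Bessel family has norm at most 1: test the inequality at the vector itself. The
crude factor `F.card` is harmless, since this only absorbs errors `ε` that may be chosen after `F`.
-/
theorem sum_inner_le_of_isBessel {ι : Type*} {F : Finset ι} {u v : ι → H} (hu : IsBessel F u)
    (hv : IsBessel F v) {T : H →L[ℂ] H} {ε : ℝ} (h : ‖T‖ ≤ ε) :
    ‖∑ i ∈ F, ⟪u i, T (v i)⟫_ℂ‖ ≤ F.card * ε := by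
  have key : ∀ w : ι → H, IsBessel F w → ∀ i ∈ F, ‖w i‖ ≤ 1 := by
    intro w hw i hi
    have h1 := (Finset.single_le_sum (f := fun j => ‖⟪w j, w i⟫_ℂ‖ ^ 2)
      (fun j _ => by positivity) hi).trans (hw (w i))
    have h2 : ‖⟪w i, w i⟫_ℂ‖ = ‖w i‖ ^ 2 := by
      rw [inner_self_eq_norm_sq_to_K]; simp
    simp only [h2] at h1
    by_contra hc
    push Not at hc
    have : 1 < ‖w i‖ ^ 2 := by nlinarith
    nlinarith
  refine (norm_sum_le _ _).trans ?_
  rw [← nsmul_eq_mul]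
  refine Finset.sum_le_card_nsmul _ _ _ fun i hi => ?_
  have hε : 0 ≤ ε := (norm_nonneg T).trans h
  calc ‖⟪u i, T (v i)⟫_ℂ‖ ≤ ‖u i‖ * ‖T (v i)‖ := norm_inner_le_norm _ _
    _ ≤ 1 * (ε * 1) := by
        gcongr
        · exact key u hu i hi
        · exact (T.le_of_opNorm_le h _).trans (by gcongr; exact key v hv i hi)
    _ = ε := by ring

variable [CompleteSpace H]

/-- Stability under contractions is the reason for working with Bessel families instead of
orthonormal ones. -/
theorem IsBessel.map {ι : Type*} {F : Finset ι} {u : ι → H} (hu : IsBessel F u) {W : H →L[ℂ] H}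
    (hW : ‖W‖ ≤ 1) : IsBessel F (fun i => W (u i)) := by
  intro x
  have h : ‖star W x‖ ≤ ‖x‖ := by
    simpa using (star W).le_of_opNorm_le ((norm_star W).trans_le hW) x
  calc ∑ i ∈ F, ‖⟪W (u i), x⟫_ℂ‖ ^ 2 = ∑ i ∈ F, ‖⟪u i, star W x⟫_ℂ‖ ^ 2 := by
        simp only [ContinuousLinearMap.star_eq_adjoint, ContinuousLinearMap.adjoint_inner_right]
    _ ≤ ‖star W x‖ ^ 2 := hu _
    _ ≤ ‖x‖ ^ 2 := by gcongr

/-- A regularized polar decomposition of a bounded operator. -/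
theorem exists_approx_polar (T : H →L[ℂ] H) {ε : ℝ} (hε : 0 < ε) :
    ∃ W : H →L[ℂ] H, ‖W‖ ≤ 1 ∧ ‖T - W * CFC.abs T‖ ≤ ε ∧ ‖CFC.abs T - star W * T‖ ≤ ε := by
  set P := CFC.abs T with hP
  have hP0 : 0 ≤ P := CFC.abs_nonneg T
  have hPs : IsSelfAdjoint P := IsSelfAdjoint.of_nonneg hP0
  have hPP : P * P = star T * T := CFC.abs_mul_abs T
  have hsp : ∀ t ∈ spectrum ℝ P, 0 ≤ t := fun t ht => spectrum_nonneg_of_nonneg hP0 ht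
  have c0 : ContinuousOn (fun t : ℝ => t) (spectrum ℝ P) := continuousOn_id
  have c1 : ContinuousOn (fun t : ℝ => (t + ε)⁻¹) (spectrum ℝ P) := by
    refine ContinuousOn.inv₀ (by fun_prop) fun t ht => ?_
    have := hsp t ht
    positivity
  have c2 : ContinuousOn (fun t : ℝ => (t + ε)⁻¹ * t) (spectrum ℝ P) := c1.mul c0
  have c3 : ContinuousOn (fun t : ℝ => t * (t + ε)⁻¹) (spectrum ℝ P) := c0.mul c1
  have c4 : ContinuousOn (fun t : ℝ => (t + ε)⁻¹ * t * t) (spectrum ℝ P) := c2.mul c0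
  -- The contraction will be `W = T(|T| + ε)⁻¹`, a bounded substitute for the partial isometry
  -- `T|T|⁻¹`. Both error estimates reduce to functions of `P = |T|`.
  set R := cfc (fun t : ℝ => (t + ε)⁻¹) P with hR
  have hRs : star R = R := IsSelfAdjoint.cfc (R := ℝ)
  have hRP : R * P = cfc (fun t : ℝ => (t + ε)⁻¹ * t) P := by
    rw [cfc_mul _ _ _ c1 c0, cfc_id' ℝ P]
  have hPR : P * R = cfc (fun t : ℝ => t * (t + ε)⁻¹) P := by
    rw [cfc_mul _ _ _ c0 c1, cfc_id' ℝ P]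
  have hTR : ‖T * R‖ ≤ 1 := by
    have h : star (T * R) * (T * R) = (R * P) * (P * R) := by
      rw [star_mul, hRs, mul_assoc R, ← mul_assoc (star T), ← hPP]
      simp only [mul_assoc]
    have h1 : ‖(R * P) * (P * R)‖ ≤ 1 := by
      rw [hRP, hPR, ← cfc_mul _ _ _ c2 c3]
      refine norm_cfc_le zero_le_one fun t ht => ?_
      have ht := hsp t ht
      have e : t * (t + ε)⁻¹ ≤ 1 := by
        rw [← div_eq_mul_inv, div_le_one (by positivity)]; linarith
      have e0 : 0 ≤ t * (t + ε)⁻¹ := by positivity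
      rw [mul_comm (t + ε)⁻¹, Real.norm_eq_abs, abs_of_nonneg (mul_nonneg e0 e0)]
      nlinarith
    rw [← h, CStarRing.norm_star_mul_self] at h1
    nlinarith [norm_nonneg (T * R)]
  refine ⟨T * R, hTR, ?_, ?_⟩
  · have h : T - T * R * P = ε • (T * R) := by
      have h1 : (1 : H →L[ℂ] H) - R * P = ε • R := by
        rw [hRP, hR, ← cfc_const_one ℝ P, ← cfc_sub _ _ _ continuousOn_const c2,
          ← cfc_smul _ _ _ c1]
        refine cfc_congr fun t ht => ?_
        have ht := hsp t ht
        have : t + ε ≠ 0 := by positivity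
        simp only [smul_eq_mul]
        field_simp
        ring
      rw [mul_assoc, ← mul_smul_comm, ← h1, mul_sub, mul_one]
    rw [h, norm_smul, Real.norm_eq_abs, abs_of_pos hε]
    exact mul_le_of_le_one_right hε.le hTR
  · have h : P - star (T * R) * T = cfc (fun t : ℝ => t - (t + ε)⁻¹ * t * t) P := by
      rw [cfc_sub _ _ _ c0 c4, cfc_mul _ _ _ c2 c0, ← hRP, cfc_id' ℝ P, star_mul, hRs,
        mul_assoc, mul_assoc, hPP]
    rw [h]
    refine norm_cfc_le hε.le fun t ht => ?_
    have ht := hsp t ht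
    have e : t - (t + ε)⁻¹ * t * t = ε * (t * (t + ε)⁻¹) := by field_simp; ring
    have e1 : t * (t + ε)⁻¹ ≤ 1 := by
      rw [← div_eq_mul_inv, div_le_one (by positivity)]; linarith
    rw [e, Real.norm_eq_abs, abs_of_nonneg (by positivity)]
    exact mul_le_of_le_one_right hε.le e1

/-- `|tr (U* T V)| ≤ c` for all finite rank contractions `U`, `V`, in terms of the images of
orthonormal families. This says that the trace norm of `T` is at most `c`. -/
def TraceBound (T : H →L[ℂ] H) (c : ℝ) : Prop :=
  ∀ (F : Finset (basisIndex H)) (u v : basisIndex H → H), IsBessel F u → IsBessel F v →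
    ‖∑ i ∈ F, ⟪u i, T (v i)⟫_ℂ‖ ≤ c

/-! ### Stability properties of trace bounds -/

theorem TraceBound.nonneg {T : H →L[ℂ] H} {c : ℝ} (h : TraceBound T c) : 0 ≤ c := by
  simpa using h ∅ (fun _ => 0) (fun _ => 0) (by simp [IsBessel]) (by simp [IsBessel])

theorem TraceBound.mono {T : H →L[ℂ] H} {c d : ℝ} (h : TraceBound T c) (hcd : c ≤ d) :
    TraceBound T d := fun F u v hu hv => (h F u v hu hv).trans hcd

theorem TraceBound.add {T T' : H →L[ℂ] H} {c c' : ℝ} (h : TraceBound T c)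
    (h' : TraceBound T' c') : TraceBound (T + T') (c + c') := by
  intro F u v hu hv
  simp only [add_apply, inner_add_right, Finset.sum_add_distrib]
  exact (norm_add_le _ _).trans (add_le_add (h F u v hu hv) (h' F u v hu hv))

theorem TraceBound.neg {T : H →L[ℂ] H} {c : ℝ} (h : TraceBound T c) : TraceBound (-T) c := by
  intro F u v hu hv
  simpa only [neg_apply, inner_neg_right, Finset.sum_neg_distrib, norm_neg] using h F u v hu hv

theorem TraceBound.sub {T T' : H →L[ℂ] H} {c c' : ℝ} (h : TraceBound T c)
    (h' : TraceBound T' c') : TraceBound (T - T') (c + c') := by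
  rw [sub_eq_add_neg]
  exact h.add h'.neg

theorem TraceBound.smul {T : H →L[ℂ] H} {c : ℝ} (h : TraceBound T c) (a : ℂ) :
    TraceBound (a • T) (‖a‖ * c) := by
  intro F u v hu hv
  simp only [smul_apply, inner_smul_right, ← Finset.mul_sum, norm_mul]
  exact mul_le_mul_of_nonneg_left (h F u v hu hv) (norm_nonneg a)

theorem TraceBound.star {T : H →L[ℂ] H} {c : ℝ} (h : TraceBound T c) :
    TraceBound (star T) c := by
  intro F u v hu hv
  refine le_of_eq_of_le ?_ (h F v u hv hu)
  rw [← Complex.norm_conj, map_sum]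
  simp only [ContinuousLinearMap.star_eq_adjoint, inner_conj_symm,
    ContinuousLinearMap.adjoint_inner_left]

/-- After scaling, `Y` is a contraction and is absorbed into the family `v`. -/
theorem TraceBound.mul_right {T : H →L[ℂ] H} {c : ℝ} (h : TraceBound T c) (Y : H →L[ℂ] H) :
    TraceBound (T * Y) (c * ‖Y‖) := by
  rcases eq_or_ne Y 0 with rfl | hY
  · intro F u v hu hv
    simp
  have hY' : 0 < ‖Y‖ := norm_pos_iff.2 hY
  have h1 : TraceBound (T * (((‖Y‖⁻¹ : ℝ) : ℂ) • Y)) c := by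
    intro F u v hu hv
    refine h F u _ hu (hv.map ?_)
    rw [norm_smul, Complex.norm_real, norm_inv, norm_norm, inv_mul_cancel₀ hY'.ne']
  have h2 := h1.smul (‖Y‖ : ℂ)
  rw [mul_smul_comm, smul_smul, ← Complex.ofReal_mul, mul_inv_cancel₀ hY'.ne',
    Complex.ofReal_one, one_smul, Complex.norm_real, norm_norm] at h2
  rwa [mul_comm]

theorem TraceBound.mul_left {T : H →L[ℂ] H} {c : ℝ} (h : TraceBound T c) (X : H →L[ℂ] H) :
    TraceBound (X * T) (‖X‖ * c) := by
  have := (h.star.mul_right (Star.star X)).star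
  rwa [star_mul, star_star, star_star, norm_star, mul_comm] at this

/-! ### Equivalence of trace norm and trace bounds -/

theorem ofReal_inner_abs_eq (T : H →L[ℂ] H) (x : H) :
    (⟪x, CFC.abs T x⟫_ℂ).re = ‖CFC.sqrt (CFC.abs T) x‖ ^ 2 := by
  have hQs : IsSelfAdjoint (CFC.sqrt (CFC.abs T)) := IsSelfAdjoint.of_nonneg (CFC.sqrt_nonneg _)
  have hsymm : ∀ x y : H, ⟪CFC.sqrt (CFC.abs T) x, y⟫_ℂ = ⟪x, CFC.sqrt (CFC.abs T) y⟫_ℂ :=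
    hQs.isSymmetric
  have : (⟪CFC.sqrt (CFC.abs T) x, CFC.sqrt (CFC.abs T) x⟫_ℂ).re =
    ‖CFC.sqrt (CFC.abs T) x‖ ^ 2 := inner_self_eq_norm_sq (𝕜 := ℂ) _
  rw [← this, hsymm, ← mul_apply_eq_comp,
    CFC.sqrt_mul_sqrt_self _ (CFC.abs_nonneg T)]

/-- Put `Q = |T|^{1/2}`; the trace norm is the squared Hilbert–Schmidt norm of `Q`. Parseval and an
exchange of sums move `Q` onto the basis vectors, where Bessel's inequality for `u` applies. -/
theorem sum_norm_sqrt_abs_le {T : H →L[ℂ] H} {c : ℝ} (hc : 0 ≤ c)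
    (h : traceNorm T ≤ ENNReal.ofReal c) {ι : Type*} {F : Finset ι} {u : ι → H}
    (hu : IsBessel F u) : ∑ i ∈ F, ‖CFC.sqrt (CFC.abs T) (u i)‖ ^ 2 ≤ c := by
  have hQs : IsSelfAdjoint (CFC.sqrt (CFC.abs T)) := IsSelfAdjoint.of_nonneg (CFC.sqrt_nonneg _)
  have hsymm : ∀ x y : H, ⟪CFC.sqrt (CFC.abs T) x, y⟫_ℂ = ⟪x, CFC.sqrt (CFC.abs T) y⟫_ℂ :=
    hQs.isSymmetric
  rw [← ENNReal.ofReal_le_ofReal_iff hc, ENNReal.ofReal_sum_of_nonneg fun i _ => by positivity]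
  refine le_trans ?_ h
  simp only [traceNorm, ofReal_inner_abs_eq]
  calc ∑ i ∈ F, ENNReal.ofReal (‖CFC.sqrt (CFC.abs T) (u i)‖ ^ 2)
      = ∑ i ∈ F, ∑' j, ENNReal.ofReal (‖⟪onb H j, CFC.sqrt (CFC.abs T) (u i)⟫_ℂ‖ ^ 2) := by
        simp only [← ofReal_norm_sq_eq_tsum (onb H)]
    _ = ∑' j, ∑ i ∈ F, ENNReal.ofReal (‖⟪onb H j, CFC.sqrt (CFC.abs T) (u i)⟫_ℂ‖ ^ 2) :=
        (Summable.tsum_finsetSum fun i _ => ENNReal.summable).symm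
    _ = ∑' j, ENNReal.ofReal (∑ i ∈ F, ‖⟪u i, CFC.sqrt (CFC.abs T) (onb H j)⟫_ℂ‖ ^ 2) := by
        simp only [ENNReal.ofReal_sum_of_nonneg fun i (_ : i ∈ F) => sq_nonneg _, ← hsymm,
          norm_inner_symm]
    _ ≤ ∑' j, ENNReal.ofReal (‖CFC.sqrt (CFC.abs T) (onb H j)‖ ^ 2) :=
        ENNReal.tsum_le_tsum fun j => ENNReal.ofReal_le_ofReal (hu _)

/-- Duality between the trace norm and finite rank contractions. -/
theorem traceNorm_le_iff {T : H →L[ℂ] H} {c : ℝ} (hc : 0 ≤ c) :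
    traceNorm T ≤ ENNReal.ofReal c ↔ TraceBound T c := by
  constructor
  · intro h F u v hu hv
    refine le_of_forall_pos_le_add fun δ hδ => ?_
    -- The approximation error is summed over `F`, so it contributes at most `δ`; the `+ 1` covers
    -- empty `F`.
    have hε : 0 < δ / (F.card + 1) := by positivity
    obtain ⟨W, hW, hTW, -⟩ := exists_approx_polar T hε
    set Q := CFC.sqrt (CFC.abs T) with hQ
    have hQs : IsSelfAdjoint Q := IsSelfAdjoint.of_nonneg (CFC.sqrt_nonneg _)
    have hsymm : ∀ x y : H, ⟪Q x, y⟫_ℂ = ⟪x, Q y⟫_ℂ := hQs.isSymmetric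
    have hQQ : Q * Q = CFC.abs T := CFC.sqrt_mul_sqrt_self _ (CFC.abs_nonneg T)
    have h1 := sum_inner_le_of_isBessel hu hv hTW
    -- Split `|T| = Q * Q` and give one factor to each side; `2ab ≤ a² + b²` then leaves two
    -- Hilbert–Schmidt sums, each at most `c`.
    have h2 : ‖∑ i ∈ F, ⟪u i, (W * CFC.abs T) (v i)⟫_ℂ‖ ≤ c := by
      have e : ∀ i, ⟪u i, (W * CFC.abs T) (v i)⟫_ℂ = ⟪Q (star W (u i)), Q (v i)⟫_ℂ := by
        intro i
        rw [hsymm, ContinuousLinearMap.star_eq_adjoint, ContinuousLinearMap.adjoint_inner_left,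
          ← hQQ]
        rfl
      have hu' := hu.map (W := star W) (by rwa [norm_star])
      calc ‖∑ i ∈ F, ⟪u i, (W * CFC.abs T) (v i)⟫_ℂ‖
          ≤ ∑ i ∈ F, ‖⟪Q (star W (u i)), Q (v i)⟫_ℂ‖ := by
            simp only [e]
            exact norm_sum_le _ _
        _ ≤ ∑ i ∈ F, (‖Q (star W (u i))‖ ^ 2 + ‖Q (v i)‖ ^ 2) / 2 := by
            refine Finset.sum_le_sum fun i _ => (norm_inner_le_norm _ _).trans ?_
            nlinarith [sq_nonneg (‖Q (star W (u i))‖ - ‖Q (v i)‖)]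
        _ ≤ (c + c) / 2 := by
            rw [← Finset.sum_div, Finset.sum_add_distrib]
            gcongr
            · exact sum_norm_sqrt_abs_le hc h hu'
            · exact sum_norm_sqrt_abs_le hc h hv
        _ = c := by ring
    have e : ∑ i ∈ F, ⟪u i, T (v i)⟫_ℂ = ∑ i ∈ F, ⟪u i, (W * CFC.abs T) (v i)⟫_ℂ +
        ∑ i ∈ F, ⟪u i, (T - W * CFC.abs T) (v i)⟫_ℂ := by
      rw [← Finset.sum_add_distrib]
      simp only [← inner_add_right, ← add_apply, add_sub_cancel]
    rw [e]
    refine (norm_add_le _ _).trans (add_le_add h2 (h1.trans ?_))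
    rw [← mul_div_assoc, div_le_iff₀ (by positivity)]
    nlinarith
  · intro h
    refine ENNReal.summable.tsum_le_of_sum_le fun F => ?_
    have hpos : ∀ i ∈ F, 0 ≤ (⟪onb H i, CFC.abs T (onb H i)⟫_ℂ).re := fun i _ => by
      rw [ofReal_inner_abs_eq]; positivity
    rw [← ENNReal.ofReal_sum_of_nonneg hpos]
    refine ENNReal.ofReal_le_ofReal (le_of_forall_pos_le_add fun δ hδ => ?_)
    have hε : 0 < δ / (F.card + 1) := by positivity
    obtain ⟨W, hW, -, hTW⟩ := exists_approx_polar T hε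
    have hb := isBessel_hilbertBasis (onb H) F
    have h1 := sum_inner_le_of_isBessel hb hb hTW
    -- Testing with `W e_i` and `e_i` produces the diagonal entries of `star W * T`, which is close
    -- to `|T|`.
    have h2 := h F _ _ (hb.map hW) hb
    have e : ∑ i ∈ F, ⟪onb H i, CFC.abs T (onb H i)⟫_ℂ = ∑ i ∈ F, ⟪W (onb H i), T (onb H i)⟫_ℂ +
        ∑ i ∈ F, ⟪onb H i, (CFC.abs T - star W * T) (onb H i)⟫_ℂ := by
      rw [← Finset.sum_add_distrib]
      refine Finset.sum_congr rfl fun i _ => ?_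
      rw [sub_apply, inner_sub_right, mul_apply_eq_comp,
        ContinuousLinearMap.star_eq_adjoint, ContinuousLinearMap.adjoint_inner_right]
      ring
    calc ∑ i ∈ F, (⟪onb H i, CFC.abs T (onb H i)⟫_ℂ).re
        = (∑ i ∈ F, ⟪onb H i, CFC.abs T (onb H i)⟫_ℂ).re := (Complex.re_sum _ _).symm
      _ ≤ ‖∑ i ∈ F, ⟪onb H i, CFC.abs T (onb H i)⟫_ℂ‖ := Complex.re_le_norm _
      _ ≤ c + δ := by
          rw [e]
          refine (norm_add_le _ _).trans (add_le_add h2 (h1.trans ?_))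
          rw [← mul_div_assoc, div_le_iff₀ (by positivity)]
          nlinarith

theorem IsTraceClass.exists_traceBound {T : H →L[ℂ] H} (h : IsTraceClass T) :
    ∃ c, TraceBound T c := by
  refine ⟨(traceNorm T).toReal, (traceNorm_le_iff ENNReal.toReal_nonneg).1 ?_⟩
  rw [ENNReal.ofReal_toReal h.ne]

theorem TraceBound.isTraceClass {T : H →L[ℂ] H} {c : ℝ} (h : TraceBound T c) :
    IsTraceClass T :=
  ((traceNorm_le_iff h.nonneg).2 h).trans_lt ENNReal.ofReal_lt_top

/-- The series for the trace of a trace class operator converges absolutely. -/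
theorem TraceBound.hasSum_trace {T : H →L[ℂ] H} {c : ℝ} (h : TraceBound T c) :
    HasSum (fun i => ⟪onb H i, T (onb H i)⟫_ℂ) (trace T) := by
  refine Summable.hasSum (Summable.of_norm ?_)
  refine summable_of_sum_le (c := c) (fun _ => norm_nonneg _) fun F => ?_
  have hb := isBessel_hilbertBasis (onb H) F
  -- Phases of the diagonal entries (`0` where the entry vanishes, as `0 / 0 = 0`). Attached to the
  -- first family, they turn the sum of the entries into the sum of their absolute values.
  set θ : basisIndex H → ℂ := fun i =>
    ⟪onb H i, T (onb H i)⟫_ℂ / ‖⟪onb H i, T (onb H i)⟫_ℂ‖ with hθ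
  have hu : IsBessel F fun i => θ i • onb H i := by
    intro x
    refine le_trans (Finset.sum_le_sum fun i _ => ?_) (hb x)
    rw [inner_smul_left, norm_mul, Complex.norm_conj]
    have : ‖θ i‖ ≤ 1 := by
      rw [hθ]
      simp only [norm_div, Complex.norm_real, norm_norm]
      exact div_self_le_one _
    gcongr
    exact mul_le_of_le_one_left (norm_nonneg _) this
  have h1 := h F _ _ hu hb
  refine le_of_eq_of_le ?_ ((Complex.re_le_norm _).trans h1)
  rw [Complex.re_sum]
  refine Finset.sum_congr rfl fun i _ => ?_
  rw [inner_smul_left, hθ]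
  simp only [map_div₀, Complex.conj_ofReal]
  rcases eq_or_ne ⟪onb H i, T (onb H i)⟫_ℂ 0 with h0 | h0
  · simp [h0]
  · have h0' : ‖⟪onb H i, T (onb H i)⟫_ℂ‖ ≠ 0 := norm_ne_zero_iff.2 h0
    rw [div_mul_eq_mul_div, ← Complex.normSq_eq_conj_mul_self, Complex.normSq_eq_norm_sq,
      ← Complex.ofReal_div, Complex.ofReal_re]
    field_simp

end HeatTrace

namespace HeatTrace

/-! ### Pointwise limits of holomorphic functions -/

/-- A pointwise limit of a locally bounded family of holomorphic functions is holomorphic. -/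
theorem differentiableOn_of_tendsto_of_locally_bounded {ι : Type*} {l : Filter ι} [l.NeBot]
    {F : ι → ℂ → ℂ} {f : ℂ → ℂ} {U : Set ℂ} (hU : IsOpen U)
    (hF : ∀ i, DifferentiableOn ℂ (F i) U)
    (hb : ∀ z ∈ U, ∃ C, ∀ᶠ w in 𝓝 z, ∀ i, ‖F i w‖ ≤ C)
    (hlim : ∀ z ∈ U, Filter.Tendsto (fun i => F i z) l (𝓝 (f z))) : DifferentiableOn ℂ f U := by
  refine TendstoLocallyUniformlyOn.differentiableOn (F := F) (φ := l) ?_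
    (Filter.Eventually.of_forall hF) hU
  rw [Metric.tendstoLocallyUniformlyOn_iff]
  intro ε hε x hx
  obtain ⟨C, hC⟩ := hb x hx
  obtain ⟨r, hr, hball⟩ := Metric.eventually_nhds_iff_ball.1 (hC.and (hU.eventually_mem hx))
  have hC0 : 0 ≤ C := by
    obtain ⟨i⟩ := l.nonempty_of_neBot
    exact (norm_nonneg _).trans ((hball x (Metric.mem_ball_self hr)).1 i)
  set L := C / (r / 4) with hL
  have hL0 : 0 ≤ L := by positivity
  -- Cauchy's estimate on circles of radius `r / 4` makes the family equi-Lipschitz near `x`, so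
  -- that convergence at the single point `x` controls a whole neighbourhood.
  have hlip : ∀ y ∈ Metric.ball x (r / 2), ∀ i, ‖F i y - F i x‖ ≤ L * ‖y - x‖ := by
    intro y hy i
    refine (convex_ball x (r / 2)).norm_image_sub_le_of_norm_deriv_le (f := F i) (𝕜 := ℂ)
      ?_ ?_ (Metric.mem_ball_self (by positivity)) hy
    · intro w hw
      have hw' := Metric.ball_subset_ball (by linarith : r / 2 ≤ r) hw
      exact (hF i).differentiableAt (hU.mem_nhds (hball w hw').2)
    · intro w hw
      have hsub : Metric.closedBall w (r / 4) ⊆ Metric.ball x r := by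
        intro v hv
        rw [Metric.mem_closedBall] at hv
        rw [Metric.mem_ball] at hw ⊢
        linarith [dist_triangle v w x]
      refine Complex.norm_deriv_le_of_forall_mem_sphere_norm_le (by positivity) ?_ ?_
      · refine DifferentiableOn.diffContOnCl_ball (U := U) (hF i) ?_
        exact fun v hv => (hball v (hsub hv)).2
      · exact fun v hv => (hball v (hsub (Metric.sphere_subset_closedBall hv))).1 i
  have hδ : 0 < min (r / 2) (ε / (3 * (L + 1))) := by positivity
  refine ⟨Metric.ball x (min (r / 2) (ε / (3 * (L + 1)))),
    mem_nhdsWithin_of_mem_nhds (Metric.ball_mem_nhds x hδ), ?_⟩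
  filter_upwards [Metric.tendsto_nhds.1 (hlim x hx) (ε / 3) (by positivity)] with i hi y hy
  have hy1 : y ∈ Metric.ball x (r / 2) := Metric.ball_subset_ball (min_le_left _ _) hy
  have hyU : y ∈ U := (hball y (Metric.ball_subset_ball (by linarith) hy1)).2
  have hy2 : L * ‖y - x‖ < ε / 3 := by
    have h1 : ‖y - x‖ < ε / (3 * (L + 1)) := by
      rw [← dist_eq_norm]; exact (Metric.mem_ball.1 hy).trans_le (min_le_right _ _)
    rw [lt_div_iff₀ (by positivity)] at h1
    nlinarith [norm_nonneg (y - x)]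
  have h1 := (hlip y hy1 i).trans_lt hy2
  have h2 : ‖f y - f x‖ ≤ L * ‖y - x‖ :=
    le_of_tendsto ((hlim y hyU).sub (hlim x hx)).norm
      (Filter.Eventually.of_forall (hlip y hy1))
  rw [dist_eq_norm] at hi ⊢
  have e : f y - F i y = (f y - f x) - (F i x - f x) - (F i y - F i x) := by ring
  rw [e]
  calc _ ≤ ‖f y - f x‖ + ‖F i x - f x‖ + ‖F i y - F i x‖ :=
        (norm_sub_le _ _).trans (by gcongr; exact norm_sub_le _ _)
    _ < ε := by linarith

variable {H : Type*} [NormedAddCommGroup H] [InnerProductSpace ℂ H]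

/-! ### Resolvent identities -/

section Resolvent

variable {S : H →ₗ.[ℂ] H} {z w : ℂ} {R A : H →L[ℂ] H}

theorem IsResolventAt.first_resolvent_identity (hR : IsResolventAt S z R)
    (hA : IsResolventAt S w A) : R - A = (z - w) • (A * R) := by
  ext y
  obtain ⟨x, hx, hy⟩ := hR.right_inv y
  have h : S x - w • (x : H) = y + (z - w) • (x : H) := by
    rw [← hy, sub_smul]; abel
  have h1 := hA.left_inv x
  rw [h, map_add, map_smul, hx] at h1
  exact sub_eq_iff_eq_add'.2 h1.symm

/-- The differences of the resolvents at two points. -/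
theorem IsResolventAt.sub_eq_mul_sub_mul {S' : H →ₗ.[ℂ] H} {R' A' : H →L[ℂ] H}
    (hR : IsResolventAt S z R) (hA : IsResolventAt S w A)
    (hR' : IsResolventAt S' z R') (hA' : IsResolventAt S' w A') :
    A' - A = (1 - (z - w) • A') * (R' - R) * (1 - (z - w) • A) := by
  -- The outer factors turn `R'` into `A'` from the left and `R` into `A` from the right; the
  -- remaining products `A' * A` cancel.
  have h1 : (1 - (z - w) • A') * R' = A' := by
    rw [sub_mul, one_mul, smul_mul_assoc, ← hR'.first_resolvent_identity hA']
    abel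
  have h2 : R * (1 - (z - w) • A) = A := by
    have := hA.first_resolvent_identity hR
    rw [← neg_sub z w, neg_smul] at this
    rw [mul_sub, mul_one, mul_smul_comm, ← neg_inj, ← sub_eq_zero]
    rw [← sub_eq_zero] at this
    rw [← this]
    abel
  rw [mul_sub (1 - (z - w) • A') R' R, h1, sub_mul A', mul_assoc _ R, h2, mul_sub, mul_one, sub_mul,
    one_mul, mul_smul_comm, smul_mul_assoc]
  abel

end Resolvent

variable [CompleteSpace H]

/-! ### The semigroup in operator norm -/

/-- The operator `(S + 1) e^{-zS}`, for `S ≥ 0` self-adjoint and `Re z > 0`. -/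
noncomputable def expNegDeriv (S : H →ₗ.[ℂ] H) (z : ℂ) : H →L[ℂ] H :=
  cfc (fun w : ℂ => expSymbol z w * w⁻¹) (resolvent S (-1))

theorem norm_expSymbol_ofReal (z : ℂ) {t : ℝ} (ht : t ≠ 0) :
    ‖expSymbol z t‖ = Real.exp (-(z.re * (t⁻¹ - 1))) := by
  rw [expSymbol_ofReal z ht, Complex.norm_exp, Complex.neg_re, Complex.re_mul_ofReal]

theorem expSymbol_add (z z' w : ℂ) : expSymbol (z + z') w = expSymbol z w * expSymbol z' w := by
  by_cases hw : w = 0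
  · simp [expSymbol, hw]
  · simp only [expSymbol, hw, if_false, ← Complex.exp_add]
    congr 1; ring

/-- With `t⁻¹ = 1 + l` and `x = Re z` this is `e^{-xl}(1 + l) ≤ 1 + 1/x`, a consequence of `xl ≤
e^{xl}`. At `t = 0` the left side is `0`. -/
theorem norm_expSymbol_mul_inv_le {z : ℂ} (hz : 0 < z.re) {t : ℝ} (ht0 : 0 ≤ t) (ht1 : t ≤ 1) :
    ‖expSymbol z t * (t : ℂ)⁻¹‖ ≤ 1 + z.re⁻¹ := by
  rcases ht0.eq_or_lt with rfl | ht
  · simp; positivity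
  rw [norm_mul, norm_expSymbol_ofReal z ht.ne', norm_inv, Complex.norm_real, Real.norm_eq_abs,
    abs_of_pos ht]
  obtain ⟨l, hl⟩ : ∃ l, t⁻¹ = 1 + l := ⟨t⁻¹ - 1, by ring⟩
  have hl0 : 0 ≤ l := by have := (one_le_inv₀ ht).2 ht1; linarith
  rw [hl, add_sub_cancel_left, Real.exp_neg, inv_mul_le_iff₀ (Real.exp_pos _)]
  have h1 := Real.add_one_le_exp (z.re * l)
  have h2 : l = z.re⁻¹ * (z.re * l) := by field_simp
  have h3 : 0 ≤ z.re * l := by positivity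
  have h4 : 0 < z.re⁻¹ := by positivity
  nlinarith

theorem commute_expNeg_expNegDeriv (S : H →ₗ.[ℂ] H) (z w : ℂ) : Commute (expNeg S z) (expNegDeriv S w) := by
  rw [expNeg_eq, expNegDeriv]
  exact cfc_commute_cfc _ _ _

theorem star_expNeg (S : H →ₗ.[ℂ] H) (z : ℂ) : star (expNeg S z) = expNeg S (star z) := by
  rw [expNeg_eq, expNeg_eq, ← cfc_star]
  refine cfc_congr fun w _ => ?_
  by_cases hw : w = 0
  · simp [expSymbol, hw]
  · simp only [expSymbol, hw, if_false, Complex.star_def, ← Complex.exp_conj, map_neg, map_mul,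
      Complex.conj_ofReal]

namespace IsNonnegSelfAdjoint

variable {S : H →ₗ.[ℂ] H} (hS : IsNonnegSelfAdjoint S)
include hS

/-- Only the point `0` matters. Half of the exponential compensates the factor `w⁻¹`, and the other
half still tends to `0`. -/
theorem continuousOn_expSymbol_mul_inv {z : ℂ} (hz : 0 < z.re) :
    ContinuousOn (fun w : ℂ => expSymbol z w * w⁻¹) (spectrum ℂ (resolvent S (-1))) := by
  have hz2 : 0 < (z / 2).re := by simpa using hz
  intro w hw
  by_cases h : w = 0
  · subst h
    have h0 : expSymbol z 0 * 0⁻¹ = 0 := by simp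
    have h1 := (hS.continuousOn_expSymbol hz2 0 hw).norm
    rw [ContinuousWithinAt, show expSymbol (z / 2) 0 = 0 by simp [expSymbol], norm_zero] at h1
    rw [ContinuousWithinAt, h0]
    refine squeeze_zero_norm' (a := fun w : ℂ => ‖expSymbol (z / 2) w‖ * (1 + (z / 2).re⁻¹))
      ?_ (by simpa using h1.mul_const (1 + (z / 2).re⁻¹))
    filter_upwards [self_mem_nhdsWithin] with w hw
    obtain ⟨t, ht0, ht1, rfl⟩ := hS.mem_spectrum hw
    rw [← add_halves z, expSymbol_add, mul_assoc, norm_mul, add_halves]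
    gcongr
    exact norm_expSymbol_mul_inv_le hz2 ht0 ht1
  · exact (hS.continuousOn_expSymbol hz w hw).mul (continuousWithinAt_id.inv₀ h)

theorem norm_expNegDeriv_le {z : ℂ} (hz : 0 < z.re) : ‖expNegDeriv S z‖ ≤ 1 + z.re⁻¹ := by
  refine norm_cfc_le (by positivity) fun w hw => ?_
  obtain ⟨t, ht0, ht1, rfl⟩ := hS.mem_spectrum hw
  exact norm_expSymbol_mul_inv_le hz ht0 ht1

theorem expNegDeriv_mul_resolvent {z : ℂ} (hz : 0 < z.re) :
    expNegDeriv S z * resolvent S (-1) = expNeg S z := by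
  have hA := hS.isStarNormal_resolvent
  have h := cfc_mul (fun w : ℂ => expSymbol z w * w⁻¹) (fun w : ℂ => w) (resolvent S (-1))
    (hS.continuousOn_expSymbol_mul_inv hz) continuousOn_id
  rw [cfc_id' ℂ (resolvent S (-1))] at h
  rw [expNegDeriv, ← h, expNeg_eq]
  refine cfc_congr fun w _ => ?_
  by_cases hw : w = 0
  · simp [expSymbol, hw]
  · simp [hw]

theorem expNeg_mul_expNegDeriv {z w : ℂ} (hz : 0 < z.re) (hw : 0 < w.re) :
    expNeg S z * expNegDeriv S w = expNegDeriv S (z + w) := by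
  rw [expNeg_eq, expNegDeriv, expNegDeriv,
    ← cfc_mul _ _ _ (hS.continuousOn_expSymbol hz) (hS.continuousOn_expSymbol_mul_inv hw)]
  simp only [expSymbol_add, mul_assoc]

theorem commute_expNeg_resolvent (z : ℂ) : Commute (expNeg S z) (resolvent S (-1)) := by
  have hA := hS.isStarNormal_resolvent
  have h := cfc_commute_cfc (expSymbol z) (fun w : ℂ => w) (resolvent S (-1))
  rwa [cfc_id' ℂ (resolvent S (-1))] at h

theorem hasDerivAt_expNeg_mul_resolvent {z : ℂ} (hz : 0 < z.re) :
    HasDerivAt (fun z => expNeg S z * resolvent S (-1))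
      (-(expNeg S z * (1 - resolvent S (-1)))) z := by
  rw [hasDerivAt_iff_isLittleO_nhds_zero]
  refine Asymptotics.IsBigO.trans_isLittleO (g := fun h : ℂ => ‖h‖ ^ 2) ?_ ?_
  · refine Asymptotics.IsBigO.of_bound (8 / z.re ^ 2) ?_
    filter_upwards [Metric.closedBall_mem_nhds (0 : ℂ) (half_pos hz)] with h hh
    rw [smul_neg, sub_neg_eq_add, norm_pow, norm_norm]
    exact hS.norm_expNeg_taylor_le hz (by simpa using hh)
  · simpa using Asymptotics.isLittleO_norm_pow_id (E' := ℂ) one_lt_two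

/-- The semigroup is holomorphic in operator norm, and `(d/dz) e^{-zS} = -S e^{-zS}`. -/
theorem hasDerivAt_expNeg_norm {z : ℂ} (hz : 0 < z.re) :
    HasDerivAt (fun z => expNeg S z) (-(expNegDeriv S z - expNeg S z)) z := by
  -- For `v` near `z`, `e^{-vS} = (S + 1)e^{-cS} · e^{-(v-c)S}(S + 1)⁻¹`. The first factor is
  -- constant, and the second is already known to be differentiable in norm.
  set c : ℂ := z / 2 with hc
  have hc0 : 0 < c.re := by simpa [hc] using hz
  have hzc : z - c = c := by rw [hc]; ring
  have hcz : c + c = z := by rw [hc]; ring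
  have hA := hS.expNegDeriv_mul_resolvent hc0
  have h1 := (hS.hasDerivAt_expNeg_mul_resolvent (z := z - c) (by rwa [hzc])).comp_sub_const z c
  have h2 := h1.const_mul (expNegDeriv S c)
  have e : expNegDeriv S c * -(expNeg S (z - c) * (1 - resolvent S (-1))) =
      -(expNegDeriv S z - expNeg S z) := by
    rw [hzc, mul_neg, ← mul_assoc, ← (commute_expNeg_expNegDeriv S c c).eq,
      hS.expNeg_mul_expNegDeriv hc0 hc0, hcz, mul_sub, mul_one, hS.expNegDeriv_mul_resolvent hz]
  rw [e] at h2
  refine h2.congr_of_eventuallyEq ?_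
  have : {v : ℂ | c.re < v.re} ∈ 𝓝 z := by
    refine (isOpen_lt continuous_const Complex.continuous_re).mem_nhds ?_
    simp only [Set.mem_ofPred_eq, hc]
    simp; linarith
  filter_upwards [this] with v hv
  have hv' : 0 < (v - c).re := by simpa using hv
  rw [(hS.commute_expNeg_resolvent _).eq, ← mul_assoc, hA, ← hS.expNeg_add hc0 hv',
    add_sub_cancel]

theorem norm_expNeg_mul_resolvent_sub_le {z : ℂ} (hz : 0 < z.re) :
    ‖expNeg S z * resolvent S (-1) - resolvent S (-1)‖ ≤ 2 * ‖z‖ := by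
  have hA := hS.isStarNormal_resolvent
  have hc := hS.continuousOn_expSymbol hz
  have e : expNeg S z * resolvent S (-1) - resolvent S (-1) =
      cfc (fun w => expSymbol z w * w - w) (resolvent S (-1)) := by
    have c1 : ContinuousOn (fun w => expSymbol z w * w) (spectrum ℂ (resolvent S (-1))) :=
      hc.mul continuousOn_id
    have c2 : ContinuousOn (fun w : ℂ => w) (spectrum ℂ (resolvent S (-1))) := continuousOn_id
    rw [cfc_sub _ _ _ c1 c2, cfc_mul _ _ _ hc c2, cfc_id' ℂ (resolvent S (-1)), expNeg_eq]
  rw [e]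
  refine norm_cfc_le (by positivity) fun w hw => ?_
  obtain ⟨t, ht0, ht1, rfl⟩ := hS.mem_spectrum hw
  rcases ht0.eq_or_lt with rfl | ht
  · simp
  set l : ℝ := t⁻¹ - 1 with hl
  have hl0 : 0 ≤ l := sub_nonneg.2 ((one_le_inv₀ ht).2 ht1)
  have htl : t * l ≤ 1 := by
    have : t * l = 1 - t := by rw [hl]; field_simp
    linarith
  have hn : ‖-(z * (l : ℂ))‖ = ‖z‖ * l := by
    rw [norm_neg, norm_mul, Complex.norm_real, Real.norm_eq_abs, abs_of_nonneg hl0]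
  -- For `‖z‖ * l > 1` the trivial bound `2` is enough.
  have key : ‖Complex.exp (-(z * (l : ℂ))) - 1‖ ≤ 2 * (‖z‖ * l) := by
    rcases le_or_gt (‖z‖ * l) 1 with h | h
    · have := Complex.norm_exp_sub_one_le (x := -(z * (l : ℂ))) (hn.trans_le h)
      rwa [hn] at this
    · have h1 : ‖Complex.exp (-(z * (l : ℂ)))‖ ≤ 1 := by
        rw [Complex.norm_exp, Real.exp_le_one_iff, Complex.neg_re, Complex.re_mul_ofReal]
        have := mul_nonneg hz.le hl0
        linarith
      have h2 := norm_sub_le (Complex.exp (-(z * (l : ℂ)))) 1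
      rw [norm_one] at h2
      linarith
  have e2 : expSymbol z t * t - t = t * (Complex.exp (-(z * (l : ℂ))) - 1) := by
    rw [expSymbol_ofReal z ht.ne', ← hl]; ring
  rw [e2, norm_mul, Complex.norm_real, Real.norm_eq_abs, abs_of_pos ht]
  calc t * ‖Complex.exp (-(z * (l : ℂ))) - 1‖ ≤ t * (2 * (‖z‖ * l)) := by gcongr
    _ = 2 * ‖z‖ * (t * l) := by ring
    _ ≤ 2 * ‖z‖ * 1 := by gcongr
    _ = 2 * ‖z‖ := mul_one _

end IsNonnegSelfAdjoint

end HeatTrace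

namespace HeatTrace

variable {H : Type*} [NormedAddCommGroup H] [InnerProductSpace ℂ H] [CompleteSpace H]

/-! ### Trace norm bounds by the mean value inequality -/

theorem TraceBound.of_tendsto {ι : Type*} {l : Filter ι} [l.NeBot] {Φ : ι → H →L[ℂ] H}
    {T : H →L[ℂ] H} {c : ℝ} (hΦ : Filter.Tendsto Φ l (𝓝 T)) (h : ∀ᶠ i in l, TraceBound (Φ i) c) :
    TraceBound T c := by
  intro F u v hu hv
  have h1 : Filter.Tendsto (fun i => ‖∑ j ∈ F, ⟪u j, Φ i (v j)⟫_ℂ‖) l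
      (𝓝 ‖∑ j ∈ F, ⟪u j, T (v j)⟫_ℂ‖) := by
    refine (tendsto_finsetSum F fun j _ => ?_).norm
    exact Filter.Tendsto.inner tendsto_const_nhds
      (((ContinuousLinearMap.apply ℂ H (v j)).continuous.tendsto T).comp hΦ)
  exact le_of_tendsto h1 (h.mono fun i hi => hi F u v hu hv)

/-- The mean value inequality is applied to each scalar test function separately, with the same
constant `c` for all of them. -/
theorem TraceBound.sub_of_hasDerivAt {Φ Φ' : ℝ → H →L[ℂ] H} {a b c : ℝ} (hab : a ≤ b)
    (hd : ∀ s ∈ Set.Icc a b, HasDerivAt Φ (Φ' s) s) (hc : ∀ s ∈ Set.Icc a b, TraceBound (Φ' s) c) :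
    TraceBound (Φ b - Φ a) (c * (b - a)) := by
  intro F u v hu hv
  have hder : ∀ s ∈ Set.Icc a b, HasDerivWithinAt (fun s => ∑ j ∈ F, ⟪u j, Φ s (v j)⟫_ℂ)
      (∑ j ∈ F, ⟪u j, Φ' s (v j)⟫_ℂ) (Set.Icc a b) s := by
    intro s hs
    refine (HasDerivAt.fun_sum fun j _ => ?_).hasDerivWithinAt
    let L : (H →L[ℂ] H) →L[ℝ] ℂ :=
      ((innerSL ℂ (u j)).comp (ContinuousLinearMap.apply ℂ H (v j))).restrictScalars ℝ
    exact L.hasFDerivAt.comp_hasDerivAt s (hd s hs)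
  have := norm_image_sub_le_of_norm_deriv_le_segment' (C := c) hder
    (fun s hs => hc s (Set.Ico_subset_Icc_self hs) F u v hu hv) b (Set.right_mem_Icc.2 hab)
  simpa only [sub_apply, inner_sub_right, Finset.sum_sub_distrib] using this

theorem traceBound_resolvent_sub_resolvent {S₁ S₂ : H →ₗ.[ℂ] H} {z w : ℂ} {c : ℝ}
    (hz₁ : z ∈ resolventSet S₁) (hz₂ : z ∈ resolventSet S₂) (hw₁ : w ∈ resolventSet S₁)
    (hw₂ : w ∈ resolventSet S₂) (h : TraceBound (resolvent S₂ z - resolvent S₁ z) c) :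
    ∃ d, TraceBound (resolvent S₂ w - resolvent S₁ w) d := by
  rw [(isResolventAt_resolvent hz₁).sub_eq_mul_sub_mul (isResolventAt_resolvent hw₁)
    (isResolventAt_resolvent hz₂) (isResolventAt_resolvent hw₂)]
  exact ⟨_, (h.mul_left _).mul_right _⟩

/-! ### Differences of semigroups -/

section Difference

variable {S₁ S₂ : H →ₗ.[ℂ] H}

/-- The product rule gives `w` times `(G₂ - E₂)E₁A₁ - E₂E₁(1 - A₁) = G₂E₁A₁ - E₂E₁`. Since `E₂ =
G₂A₂` and `A₁` commutes with `E₁`, the difference `A₁ - A₂` appears between `G₂` and `E₁`. -/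
theorem hasDerivAt_interpolation (h₁ : IsNonnegSelfAdjoint S₁) (h₂ : IsNonnegSelfAdjoint S₂)
    {w : ℂ} (hw : 0 < w.re) {s : ℝ} (hs0 : 0 < s) (hs2 : s < 2) :
    HasDerivAt (fun s : ℝ => expNeg S₂ ((2 - s) * w) * (expNeg S₁ (s * w) * resolvent S₁ (-1)))
      (w • (expNegDeriv S₂ ((2 - s) * w) * (resolvent S₁ (-1) - resolvent S₂ (-1)) *
        expNeg S₁ (s * w))) s := by
  have hr1 : 0 < ((s : ℂ) * w).re := by rw [Complex.re_ofReal_mul]; positivity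
  have hr2 : 0 < ((2 - (s : ℂ)) * w).re := by
    rw [show (2 - (s : ℂ)) = ((2 - s : ℝ) : ℂ) by push_cast; rfl, Complex.re_ofReal_mul]
    exact mul_pos (by linarith) hw
  have d1 : HasDerivAt (fun s : ℝ => (s : ℂ) * w) w s := by
    simpa using (Complex.ofRealCLM.hasDerivAt (x := s)).mul_const w
  have d2 : HasDerivAt (fun s : ℝ => (2 - (s : ℂ)) * w) (-w) s := by
    simpa using ((Complex.ofRealCLM.hasDerivAt (x := s)).const_sub 2).mul_const w
  have e1 := (h₁.hasDerivAt_expNeg_mul_resolvent hr1).scomp s d1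
  have e2 := (h₂.hasDerivAt_expNeg_norm hr2).scomp s d2
  have e := e2.mul e1
  refine e.congr_deriv ?_
  simp only [Function.comp_apply, neg_smul, smul_neg, neg_neg, mul_neg, smul_mul_assoc,
    mul_smul_comm, ← smul_sub, ← sub_eq_add_neg]
  congr 1
  have hc := (h₁.commute_expNeg_resolvent (s * w)).eq
  have hG := h₂.expNegDeriv_mul_resolvent hr2
  rw [mul_sub (expNegDeriv S₂ _), hG]
  generalize expNeg S₂ ((2 - s) * w) = E, expNegDeriv S₂ ((2 - s) * w) = G
  simp only [mul_sub, sub_mul, mul_one, hc, mul_assoc]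
  abel

/-- The operator equals `G E₂(2w)A₂ - G E₂(w)A₂E₁(w)` with `G = G₂(w)`. Replacing `A₂` by `A₁` costs
`2(1 + 1/Re w)K`; what remains is the Duhamel increment multiplied by `G`, which costs `|w|(1 + 1/Re
w)²K`. -/
theorem traceBound_expNeg_mul_sub (h₁ : IsNonnegSelfAdjoint S₁) (h₂ : IsNonnegSelfAdjoint S₂)
    {K : ℝ} (hK : TraceBound (resolvent S₂ (-1) - resolvent S₁ (-1)) K) {w : ℂ} (hw : 0 < w.re) :
    TraceBound (expNeg S₂ (2 * w) * (expNeg S₂ w - expNeg S₁ w))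
      ((‖w‖ * (1 + w.re⁻¹) ^ 2 + 2 * (1 + w.re⁻¹)) * K) := by
  set M := 1 + w.re⁻¹ with hM
  have hM0 : 0 < M := by positivity
  have hK0 := hK.nonneg
  have hw2 : 0 < (2 * w).re := by simpa using hw
  set A₁ := resolvent S₁ (-1) with hA₁
  set A₂ := resolvent S₂ (-1) with hA₂
  set G := expNegDeriv S₂ w with hG
  have hGn : ‖G‖ ≤ M := h₂.norm_expNegDeriv_le hw
  set Ψ : ℝ → H →L[ℂ] H :=
    fun s => expNeg S₂ ((2 - s) * w) * (expNeg S₁ (s * w) * A₁) with hΨ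
  have bound : ∀ s ∈ Set.Ioc (0 : ℝ) 1, TraceBound (G * Ψ 1 - G * Ψ s) (‖w‖ * M ^ 2 * K) := by
    intro s hs
    refine (TraceBound.sub_of_hasDerivAt (Φ := fun s => G * Ψ s) (c := ‖w‖ * M ^ 2 * K) hs.2
      (fun t ht => (hasDerivAt_interpolation h₁ h₂ hw (hs.1.trans_le ht.1)
        (ht.2.trans_lt one_lt_two)).const_mul G) fun t ht => ?_).mono ?_
    · have ht0 := hs.1.trans_le ht.1
      have hr1 : 0 < ((t : ℂ) * w).re := by rw [Complex.re_ofReal_mul]; positivity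
      have hr2 : w.re ≤ ((2 - (t : ℂ)) * w).re := by
        rw [show (2 - (t : ℂ)) = ((2 - t : ℝ) : ℂ) by push_cast; rfl, Complex.re_ofReal_mul]
        nlinarith [ht.2]
      have n1 := h₁.norm_expNeg_le hr1
      have n2 : ‖expNegDeriv S₂ ((2 - t) * w)‖ ≤ M := by
        refine (h₂.norm_expNegDeriv_le (hw.trans_le hr2)).trans ?_
        rw [hM]
        gcongr
      have hK' : TraceBound (A₁ - A₂) K := by simpa using hK.neg
      rw [mul_smul_comm]
      refine ((((hK'.mul_left (expNegDeriv S₂ ((2 - t) * w))).mul_right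
        (expNeg S₁ (t * w))).mul_left G).smul w).mono ?_
      calc ‖w‖ * (‖G‖ * (‖expNegDeriv S₂ ((2 - t) * w)‖ * K * ‖expNeg S₁ (t * w)‖))
          ≤ ‖w‖ * (M * (M * K * 1)) := by gcongr
        _ = ‖w‖ * M ^ 2 * K := by ring
    · exact mul_le_of_le_one_right (by positivity) (by linarith [hs.1])
  -- The endpoint `s = 0` is reached only as a limit, as the norm derivatives require positive real
  -- part. The factor `A₁` makes `E₁(sw)A₁ → A₁` hold in operator norm.
  have lim : Filter.Tendsto Ψ (𝓝[>] 0) (𝓝 (expNeg S₂ (2 * w) * A₁)) := by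
    refine Filter.Tendsto.mul ?_ ?_
    · have c1 : Filter.Tendsto (fun s : ℝ => (2 - (s : ℂ)) * w) (𝓝[>] 0) (𝓝 (2 * w)) := by
        have : Continuous fun s : ℝ => (2 - (s : ℂ)) * w := by fun_prop
        simpa using (this.tendsto 0).mono_left nhdsWithin_le_nhds
      exact (h₂.hasDerivAt_expNeg_norm hw2).continuousAt.tendsto.comp c1
    · rw [tendsto_iff_norm_sub_tendsto_zero]
      refine squeeze_zero' (g := fun s : ℝ => 2 * ‖(s : ℂ) * w‖)
        (Filter.Eventually.of_forall fun _ => norm_nonneg _) ?_ ?_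
      · filter_upwards [self_mem_nhdsWithin] with s hs
        have hs : 0 < s := hs
        exact h₁.norm_expNeg_mul_resolvent_sub_le (by rw [Complex.re_ofReal_mul]; positivity)
      · have : Continuous fun s : ℝ => 2 * ‖(s : ℂ) * w‖ := by fun_prop
        simpa using (this.tendsto 0).mono_left nhdsWithin_le_nhds
  have key : TraceBound (G * Ψ 1 - G * (expNeg S₂ (2 * w) * A₁)) (‖w‖ * M ^ 2 * K) := by
    refine TraceBound.of_tendsto ((lim.const_mul G).const_sub (G * Ψ 1)) ?_
    filter_upwards [Ioc_mem_nhdsGT one_pos] with s hs using bound s hs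
  have t1 := (hK.mul_left (G * expNeg S₂ (2 * w)))
  have t2 := (hK.mul_left (G * expNeg S₂ w)).mul_right (expNeg S₁ w)
  have n0 := h₁.norm_expNeg_le hw
  have n1 : ‖G * expNeg S₂ (2 * w)‖ ≤ M :=
    (norm_mul_le _ _).trans ((mul_le_of_le_one_right (norm_nonneg _)
      (h₂.norm_expNeg_le hw2)).trans hGn)
  have n2 : ‖G * expNeg S₂ w‖ ≤ M :=
    (norm_mul_le _ _).trans ((mul_le_of_le_one_right (norm_nonneg _)
      (h₂.norm_expNeg_le hw)).trans hGn)
  have eG : ∀ v : ℂ, 0 < v.re → G * expNeg S₂ v * A₂ = expNeg S₂ v * expNeg S₂ w := by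
    intro v hv
    rw [← (commute_expNeg_expNegDeriv S₂ v w).eq, mul_assoc, h₂.expNegDeriv_mul_resolvent hw]
  have e : expNeg S₂ (2 * w) * (expNeg S₂ w - expNeg S₁ w) =
      G * expNeg S₂ (2 * w) * (A₂ - A₁) - G * expNeg S₂ w * (A₂ - A₁) * expNeg S₁ w -
        (G * Ψ 1 - G * (expNeg S₂ (2 * w) * A₁)) := by
    have e1 : Ψ 1 = expNeg S₂ w * (A₁ * expNeg S₁ w) := by
      rw [hΨ, hA₁, ← (h₁.commute_expNeg_resolvent w).eq]
      simp only [Complex.ofReal_one, one_mul]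
      norm_num
    have e2 : expNeg S₂ w * expNeg S₂ w = expNeg S₂ (2 * w) := by
      rw [← h₂.expNeg_add hw hw, two_mul]
    rw [mul_sub (G * expNeg S₂ (2 * w)), mul_sub (G * expNeg S₂ w), eG _ hw, eG _ hw2, e1, e2,
      mul_sub, sub_mul]
    simp only [mul_assoc]
    abel
  rw [e]
  refine ((t1.sub t2).sub key).mono ?_
  have i1 : ‖G * expNeg S₂ (2 * w)‖ * K ≤ M * K := by gcongr
  have i2 : ‖G * expNeg S₂ w‖ * K * ‖expNeg S₁ w‖ ≤ M * K * 1 := by gcongr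
  linarith

/-- The adjoint of the preceding bound, with the two operators exchanged and `w` conjugated. -/
theorem traceBound_sub_mul_expNeg (h₁ : IsNonnegSelfAdjoint S₁) (h₂ : IsNonnegSelfAdjoint S₂)
    {K : ℝ} (hK : TraceBound (resolvent S₂ (-1) - resolvent S₁ (-1)) K) {w : ℂ} (hw : 0 < w.re) :
    TraceBound ((expNeg S₂ w - expNeg S₁ w) * expNeg S₁ (2 * w))
      ((‖w‖ * (1 + w.re⁻¹) ^ 2 + 2 * (1 + w.re⁻¹)) * K) := by
  have hK' : TraceBound (resolvent S₁ (-1) - resolvent S₂ (-1)) K := by simpa using hK.neg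
  have h := (traceBound_expNeg_mul_sub h₂ h₁ hK' (w := star w) (by simpa using hw)).neg.star
  have e : star (2 * star w) = 2 * w := by simp
  rw [← mul_neg, neg_sub, star_mul, star_sub, star_expNeg, star_expNeg, star_expNeg, star_star,
    e] at h
  simpa using h

theorem traceBound_expNeg_sub_expNeg (h₁ : IsNonnegSelfAdjoint S₁) (h₂ : IsNonnegSelfAdjoint S₂)
    {K : ℝ} (hK : TraceBound (resolvent S₂ (-1) - resolvent S₁ (-1)) K) {w : ℂ} (hw : 0 < w.re) :
    TraceBound (expNeg S₂ (4 * w) - expNeg S₁ (4 * w))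
      (4 * ((‖w‖ * (1 + w.re⁻¹) ^ 2 + 2 * (1 + w.re⁻¹)) * K)) := by
  set B := (‖w‖ * (1 + w.re⁻¹) ^ 2 + 2 * (1 + w.re⁻¹)) * K with hB
  have hw2 : 0 < (2 * w).re := by simpa using hw
  have b1 : TraceBound (expNeg S₂ (2 * w) * (expNeg S₂ w - expNeg S₁ w)) B :=
    traceBound_expNeg_mul_sub h₁ h₂ hK hw
  have b2 : TraceBound ((expNeg S₂ w - expNeg S₁ w) * expNeg S₁ (2 * w)) B :=
    traceBound_sub_mul_expNeg h₁ h₂ hK hw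
  have hB0 := b1.nonneg
  have sq : ∀ {S : H →ₗ.[ℂ] H}, IsNonnegSelfAdjoint S → expNeg S (2 * w) =
      expNeg S w * expNeg S w := fun hS => by rw [← hS.expNeg_add hw hw, two_mul]
  have sq2 : ∀ {S : H →ₗ.[ℂ] H}, IsNonnegSelfAdjoint S → expNeg S (4 * w) =
      expNeg S (2 * w) * expNeg S (2 * w) := fun hS => by
    rw [← hS.expNeg_add hw2 hw2]; congr 1; ring
  -- Telescoping of a difference of fourth powers. The exponent 4 guarantees that each term has two
  -- factors `E₂(w)` on the left of the difference or two factors `E₁(w)` on its right.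
  have e : expNeg S₂ (4 * w) - expNeg S₁ (4 * w) =
      expNeg S₂ w * (expNeg S₂ (2 * w) * (expNeg S₂ w - expNeg S₁ w)) +
      expNeg S₂ (2 * w) * (expNeg S₂ w - expNeg S₁ w) * expNeg S₁ w +
      expNeg S₂ w * ((expNeg S₂ w - expNeg S₁ w) * expNeg S₁ (2 * w)) +
      (expNeg S₂ w - expNeg S₁ w) * expNeg S₁ (2 * w) * expNeg S₁ w := by
    rw [sq2 h₁, sq2 h₂, sq h₁, sq h₂]
    noncomm_ring
  have n1 := h₁.norm_expNeg_le hw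
  have n2 := h₂.norm_expNeg_le hw
  rw [e]
  refine ((((b1.mul_left _).add (b1.mul_right _)).add (b2.mul_left _)).add
    (b2.mul_right _)).mono ?_
  nlinarith

theorem exists_traceBound_expNeg_sub_expNeg_sector (h₁ : IsNonnegSelfAdjoint S₁)
    (h₂ : IsNonnegSelfAdjoint S₂) {K : ℝ}
    (hK : TraceBound (resolvent S₂ (-1) - resolvent S₁ (-1)) K) {κ : ℝ} (hκ : 0 < κ) :
    ∃ C, 0 < C ∧ ∀ z : ℂ, z ≠ 0 → κ * ‖z‖ ≤ z.re →
      TraceBound (expNeg S₂ z - expNeg S₁ z) (C * (‖z‖⁻¹ + ‖z‖)) := by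
  have hK0 := hK.nonneg
  -- The final `+ 1` keeps the constant positive when `K = 0`.
  refine ⟨4 * ((2 * (1 + 4 / κ) ^ 2 + 4 * (1 + 4 / κ)) * K) + 1, by positivity, fun z hz hre => ?_⟩
  set r := ‖z‖ with hr
  have hr0 : 0 < r := norm_pos_iff.2 hz
  have hre0 : 0 < z.re := lt_of_lt_of_le (by positivity) hre
  have h4 : (4 : ℂ) * (z / 4) = z := by ring
  have hw : (z / 4).re = z.re / 4 := by simp
  have hn : ‖z / 4‖ = r / 4 := by simp [hr]
  have hb := traceBound_expNeg_sub_expNeg h₁ h₂ hK (w := z / 4) (by rw [hw]; positivity)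
  rw [h4, hw, hn] at hb
  refine hb.mono ?_
  have hM : 1 + (z.re / 4)⁻¹ ≤ (1 + 4 / κ) * (1 + r⁻¹) := by
    have : (z.re / 4)⁻¹ ≤ (κ * r / 4)⁻¹ := by gcongr
    have e : (κ * r / 4)⁻¹ = 4 / κ * r⁻¹ := by field_simp
    have p1 : 0 < 4 / κ := by positivity
    have p2 : 0 < r⁻¹ := by positivity
    nlinarith
  have hrr : r * r⁻¹ = 1 := mul_inv_cancel₀ hr0.ne'
  have p2 : 0 < r⁻¹ := by positivity
  have h1 : 1 + r⁻¹ ≤ 2 * (r⁻¹ + r) := by nlinarith [sq_nonneg (r - 1), sq_nonneg (r⁻¹ - 1)]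
  -- The factor `r` from the length of the Duhamel path reduces the singularity `r⁻²` to `r⁻¹`.
  have h2 : r / 4 * (1 + r⁻¹) ^ 2 ≤ 2 * (r⁻¹ + r) := by
    have : r / 4 * (1 + r⁻¹) ^ 2 = (r + 2 + r⁻¹) / 4 := by
      have : r / 4 * (1 + r⁻¹) ^ 2 = (r + 2 * (r * r⁻¹) + r⁻¹ * (r * r⁻¹)) / 4 := by ring
      rw [this, hrr]; ring
    rw [this]
    nlinarith [sq_nonneg (r - 1)]
  have p0 : 0 ≤ 1 + (z.re / 4)⁻¹ := by positivity
  set k := 1 + 4 / κ with hk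
  have hk0 : 0 < k := by positivity
  calc 4 * ((r / 4 * (1 + (z.re / 4)⁻¹) ^ 2 + 2 * (1 + (z.re / 4)⁻¹)) * K)
      ≤ 4 * ((r / 4 * (k * (1 + r⁻¹)) ^ 2 + 2 * (k * (1 + r⁻¹))) * K) := by gcongr
    _ = 4 * ((k ^ 2 * (r / 4 * (1 + r⁻¹) ^ 2) + 2 * k * (1 + r⁻¹)) * K) := by ring
    _ ≤ 4 * ((k ^ 2 * (2 * (r⁻¹ + r)) + 2 * k * (2 * (r⁻¹ + r))) * K) := by gcongr
    _ = 4 * ((2 * k ^ 2 + 4 * k) * K) * (r⁻¹ + r) := by ring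
    _ ≤ (4 * ((2 * k ^ 2 + 4 * k) * K) + 1) * (r⁻¹ + r) := by gcongr; linarith

end Difference

end HeatTrace

/-! ### The main theorem -/

theorem theoremt3p9 {H : Type*} [NormedAddCommGroup H] [InnerProductSpace ℂ H] [CompleteSpace H]
    [TopologicalSpace.SeparableSpace H] (S₁ S₂ : H →ₗ.[ℂ] H)
    (hS₁ : HeatTrace.IsNonnegSelfAdjoint S₁) (hS₂ : HeatTrace.IsNonnegSelfAdjoint S₂)
    (hR : ∃ z₀ ∈ HeatTrace.resolventSet S₁ ∩ HeatTrace.resolventSet S₂,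
      HeatTrace.IsTraceClass (HeatTrace.resolvent S₂ z₀ - HeatTrace.resolvent S₁ z₀)) :
    (∀ z : ℂ, 0 < z.re → HeatTrace.IsTraceClass (HeatTrace.expNeg S₂ z - HeatTrace.expNeg S₁ z)) ∧
    AnalyticOnNhd ℂ (fun z => HeatTrace.trace (HeatTrace.expNeg S₂ z - HeatTrace.expNeg S₁ z))
      {z : ℂ | 0 < z.re} ∧
    ∀ φ ∈ Set.Ioo 0 (Real.pi / 2), ∃ C : ℝ, 0 < C ∧ ∀ z ∈ HeatTrace.sector φ,
      HeatTrace.traceNorm (HeatTrace.expNeg S₂ z - HeatTrace.expNeg S₁ z) ≤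
        ENNReal.ofReal (C * (‖z‖⁻¹ + ‖z‖)) := by
  obtain ⟨z₀, ⟨hz₁, hz₂⟩, hT⟩ := hR
  obtain ⟨c, hc⟩ := hT.exists_traceBound
  obtain ⟨K, hK⟩ := HeatTrace.traceBound_resolvent_sub_resolvent hz₁ hz₂ hS₁.neg_one_mem
    hS₂.neg_one_mem hc
  have hbound : ∀ z : ℂ, 0 < z.re → ∃ C, ∀ᶠ w in 𝓝 z,
      HeatTrace.TraceBound (HeatTrace.expNeg S₂ w - HeatTrace.expNeg S₁ w) C := by
    intro z hz
    have hz0 : z ≠ 0 := by rintro rfl; simp at hz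
    have hn : 0 < ‖z‖ := norm_pos_iff.2 hz0
    -- Half the ratio `Re z / |z|`: the sector condition with this constant is strict at `z`, hence
    -- holds in a neighbourhood.
    have hκ : 0 < z.re / ‖z‖ / 2 := by positivity
    obtain ⟨C, -, hC⟩ :=
      HeatTrace.exists_traceBound_expNeg_sub_expNeg_sector hS₁ hS₂ hK hκ
    refine ⟨C * (‖z‖⁻¹ + ‖z‖) + 1, ?_⟩
    have e1 : ∀ᶠ w : ℂ in 𝓝 z, z.re / ‖z‖ / 2 * ‖w‖ < w.re := by
      refine ContinuousAt.eventually_lt (by fun_prop) (by fun_prop) ?_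
      have : z.re / ‖z‖ / 2 * ‖z‖ = z.re / 2 := by field_simp
      rw [this]; linarith
    have e2 : ∀ᶠ w : ℂ in 𝓝 z, C * (‖w‖⁻¹ + ‖w‖) < C * (‖z‖⁻¹ + ‖z‖) + 1 := by
      refine ContinuousAt.eventually_lt ?_ (by fun_prop) (by linarith)
      have := hn.ne'
      fun_prop (disch := assumption)
    filter_upwards [e1, e2, isOpen_ne.mem_nhds hz0] with w h1 h2 h3
    exact (hC w h3 h1.le).mono h2.le
  have hopen : IsOpen {z : ℂ | 0 < z.re} := isOpen_lt continuous_const Complex.continuous_re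
  refine ⟨fun z hz => ?_, ?_, fun φ hφ => ?_⟩
  · obtain ⟨C, hC⟩ := hbound z hz
    exact hC.self_of_nhds.isTraceClass
  · refine DifferentiableOn.analyticOnNhd ?_ hopen
    refine HeatTrace.differentiableOn_of_tendsto_of_locally_bounded (l := Filter.atTop)
      (F := fun (F : Finset (HeatTrace.basisIndex H)) z => ∑ i ∈ F, ⟪HeatTrace.onb H i,
        (HeatTrace.expNeg S₂ z - HeatTrace.expNeg S₁ z) (HeatTrace.onb H i)⟫_ℂ)
      hopen ?_ ?_ ?_
    · intro F z hz
      refine (DifferentiableAt.fun_sum fun i _ => ?_).differentiableWithinAt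
      have hd := ((hS₂.hasDerivAt_expNeg_norm hz).sub
        (hS₁.hasDerivAt_expNeg_norm hz)).differentiableAt
      exact ((innerSL ℂ (HeatTrace.onb H i)).comp
        (ContinuousLinearMap.apply ℂ H (HeatTrace.onb H i))).differentiableAt.comp z hd
    · intro z hz
      obtain ⟨C, hC⟩ := hbound z hz
      refine ⟨C, hC.mono fun w hw F => ?_⟩
      -- Partial sums of the trace are themselves test sums, so the trace bound controls them
      -- uniformly in `F`.
      exact hw F _ _ (HeatTrace.isBessel_hilbertBasis _ F) (HeatTrace.isBessel_hilbertBasis _ F)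
    · intro z hz
      obtain ⟨C, hC⟩ := hbound z hz
      exact hC.self_of_nhds.hasSum_trace
  · have hκ : 0 < Real.cos φ :=
      Real.cos_pos_of_mem_Ioo ⟨by linarith [hφ.1, Real.pi_pos], hφ.2⟩
    obtain ⟨C, hC0, hC⟩ :=
      HeatTrace.exists_traceBound_expNeg_sub_expNeg_sector hS₁ hS₂ hK hκ
    refine ⟨C, hC0, fun z hz => ?_⟩
    have hz0 : 0 < ‖z‖ := norm_pos_iff.2 hz.1
    refine (HeatTrace.traceNorm_le_iff (by positivity)).2 (hC z hz.1 ?_)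
    have hcos : Real.cos φ ≤ Real.cos z.arg := by
      rw [← Real.cos_abs z.arg]
      exact Real.cos_le_cos_of_nonneg_of_le_pi (abs_nonneg _)
        (by linarith [hφ.2, Real.pi_pos]) hz.2.le
    calc Real.cos φ * ‖z‖ ≤ Real.cos z.arg * ‖z‖ := by gcongr
      _ = z.re := by rw [mul_comm, Complex.norm_mul_cos_arg]
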